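/- **Model.** A $k$-unicast instance consists of a finite connected undirected graph $G$ with edge capacities $c_e\in\mathbb Z_{\ge1}$ and $k$ sessions $(s_i,t_i,d_i)$, where the source $s_i$ holds a packet of $d_i\in\mathbb Z_{\ge 1}$ sub-packets (symbols of a finite alphabet $\Gamma$ with $|\Gamma|\ge2$) wanted by the sink $t_i$. Protocols run in synchronous rounds; in every round each edge $e$ carries $c_e$ symbols in each of its two directions. In a *coding protocol* the symbols sent by a node may be any function of the packets originating there and of what it received in earlier rounds; in a *routing protocol* a node may only forward sub-packets that originate there or that it received in earlier rounds. The *makespan* of a protocol is the number of rounds after which every sink $t_i$ can determine the packet of $s_i$ (for routing: has received all its sub-packets). The *makespan coding gap* of an instance is the smallest makespan of a routing protocol divided by the smallest makespan of a coding protocol. A *gap instance* $I=(G,\mathcal S,F)$ is a $k$-unicast instance with unit capacities and demands, in which terminals of different sessions are distinct, with a set $F\subseteq E(G)$ of cut edges. It has parameters $(a,b,f,k,m,r,u)$ if over every alphabet $\Gamma$ as above it has a coding protocol of makespan at most $a$, $\mathrm{dist}_{G\setminus F}(s_i,t_i)\ge b$ for all $i$, $|F|=f>0$, there are $k$ sessions,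 $|E(G)|\le m$, $k/f\ge r$ and $m/f\le u$. *Base instance* with $r$ sessions: nodes $s_i,t_i$ ($1\le i\le r$), $S$, $T$; edges $s_iS$, $ST$, $Tt_i$; for all $i\ne j$ a path of $3$ edges from $s_i$ to $t_j$; cut edges $F=\{ST\}$. *Product.* Let $I_1$ (outer) and $I_2$ (inner) be gap instances and let $\vec E_1$ consist of the two anti-parallel arcs of every non-cut edge of $I_1$. A *colored bipartite graph* $B$ for them is a finite bipartite graph on $L\sqcup R$ with edge colors $\chi_1\in\vec E_1$ and $\chi_2\in\mathcal S_2$ such that at every $v\in L$ each $\chi_1$-color occurs on exactly one edge and $\chi_2$ is constant, and at every $w\in R$ each $\chi_2$-color occurs on exactly one edge and $\chi_1$ is constant. The product along $B$ with path length $\ell$ is obtained from one copy of $V(G_1)$ for each $v\in L$ and one copy of $G_2$ for each $w\in R$ as follows. For each edge $vw$ of $B$, merge the tail and the head of the arc $\chi_1(vw)$ in copy $v$ with the source and the sink of session $\chi_2(vw)$ in copy $w$. In each outer copy replace each cut edge by a path of $\ell$ edges, and drop the non-cut edges. The sessions are those of the outer copies; the cut edges are those of the inner copies and the first edge of each replacement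 path. Capacities and demands are one. **Theorem.** There are absolute constants $c,C>0$ and $D\in\mathbb N$, gap instances $I(i,r)$ and natural numbers $f_{i,r},k_{i,r},m_{i,r},u_{i,r}$ with $u_{i,r}\ge5$ ($i\ge0$, $r\ge5$ integers) such that: 1. $I(0,r)$ is the base instance with $r$ sessions, and $I(i+1,r)$ is the product, with path length $3^{2^i}$, of the outer instance $I(i,3r)$ and the inner instance $I(i,u_{i,3r})$ along some colored bipartite graph of girth at least $2\cdot5^{2^i}\cdot 5^{2^i}$. 2. $I(i,r)$ has parameters $(3^{2^i},5^{2^i},f_{i,r},k_{i,r},m_{i,r},r,u_{i,r})$, and $m_{i,r},k_{i,r}\le r^{2^{D\cdot2^i}}$; in particular its coding makespan is at most $3^{2^i}$. 3. If $r\ge2\cdot5^{2^i}$, every routing protocol for $I(i,r)$ has makespan at least $5^{2^i}$. 4. For the instances $M_i=I(i,2\cdot5^{2^i})$, the number $k=k_{i,2\cdot 5^{2^i}}$ of sessions tends to infinity with $i$, and for every $i$ and every finite alphabet $\Gamma$ with $|\Gamma|\ge2$ the makespan coding gap of $M_i$ is at least $C\,(\log k)^c$. In particular there is an infinite family of $k$-unicast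 instances with unit demands and capacities, with $k$ unbounded, whose makespan coding gap is $\Omega(\log^c k)$ for an absolute constant $c>0$. -/

import Mathlib

/-- The data of a multiple-unicast instance: a finite undirected network with edge capacities
and a finite family of sessions, each with a source, a sink and a demand (its number of
sub-packets).  The number `k` of sessions is `Nat.card ι`. -/
structure UnicastInstance where
  V : Type
  finV : Finite V
  graph : SimpleGraph V
  cap : Sym2 V → ℕ
  ι : Type
  finι : Finite ι
  src : ι → V
  snk : ι → V
  dem : ι → ℕ

namespace UnicastInstance

variable (M : UnicastInstance)

/-- An assignment of contents (sub-packets from the alphabet `Γ`) to the packets of all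
sessions. -/
abbrev Messages (Γ : Type) : Type := (i : M.ι) → Fin (M.dem i) → Γ

/-- A family of coding functions: `P t u v x` is what `u` sends to `v` in round `t`
(rounds are numbered from `0`) when the packets are `x`.  In each round every edge carries, in
each of its two directions, as many sub-packets as its capacity. -/
abbrev CodingFunctions (Γ : Type) : Type :=
  ℕ → (u v : M.V) → M.Messages Γ → Fin (M.cap s(u, v)) → Γ

variable {M}

/-- The information available at `v` after `t` rounds (the packets originating at `v` and
everything received by `v` in these rounds) is the same for the packets `x` and `x'`. -/
def SameHistory {Γ : Type} (P : M.CodingFunctions Γ) (v : M.V) (t : ℕ)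
    (x x' : M.Messages Γ) : Prop :=
  (∀ i, M.src i = v → x i = x' i) ∧
    ∀ r < t, ∀ u, M.graph.Adj u v → P r u v x = P r u v x'

/-- A network coding protocol: whatever a node sends is a function of its history. -/
def IsCodingProtocol {Γ : Type} (P : M.CodingFunctions Γ) : Prop :=
  ∀ t u v, M.graph.Adj u v → ∀ x x', SameHistory P u t x x' → P t u v x = P t u v x'

/-- After `τ i` rounds the sink of session `i` can determine the packet of session `i`. -/
def CodingCompletionTimes {Γ : Type} (P : M.CodingFunctions Γ) (τ : M.ι → ℕ) : Prop :=
  ∀ i x x', SameHistory P (M.snk i) (τ i) x x' → x i = x' i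

variable (M)

/-- There is a network coding protocol over the alphabet `Γ` with makespan at most `T`. -/
def CodingMakespanLE (Γ : Type) (T : ℕ) : Prop :=
  ∃ (P : M.CodingFunctions Γ) (τ : M.ι → ℕ),
    IsCodingProtocol P ∧ CodingCompletionTimes P τ ∧ ∀ i, τ i ≤ T

/-- The sub-packets: sub-packet number `j` of session `i`. -/
abbrev SubPacket : Type := (i : M.ι) × Fin (M.dem i)

/-- A schedule of a routing protocol: which sub-packets (if any) `u` sends to `v` in round `t`. -/
abbrev RoutingSchedule : Type :=
  ℕ → (u v : M.V) → Fin (M.cap s(u, v)) → Option M.SubPacket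

variable {M}

/-- After `t` rounds the node `v` has the sub-packet `p`: it originates at `v` or was received
by `v`. -/
def Holds (P : M.RoutingSchedule) (v : M.V) (t : ℕ) (p : M.SubPacket) : Prop :=
  M.src p.1 = v ∨ ∃ r < t, ∃ u, M.graph.Adj u v ∧ ∃ j, P r u v j = some p

/-- A routing protocol: a node only forwards sub-packets which it has. -/
def IsRoutingProtocol (P : M.RoutingSchedule) : Prop :=
  ∀ t u v, M.graph.Adj u v → ∀ j p, P t u v j = some p → Holds P u t p

/-- After `τ i` rounds the sink of session `i` has all sub-packets of session `i`. -/
def RoutingCompletionTimes (P : M.RoutingSchedule) (τ : M.ι → ℕ) : Prop :=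
  ∀ i, ∀ j : Fin (M.dem i), Holds P (M.snk i) (τ i) ⟨i, j⟩

variable (M)

/-- There is a routing protocol with makespan at most `T`. -/
def RoutingMakespanLE (T : ℕ) : Prop :=
  ∃ (P : M.RoutingSchedule) (τ : M.ι → ℕ),
    IsRoutingProtocol P ∧ RoutingCompletionTimes P τ ∧ ∀ i, τ i ≤ T

/-- The smallest makespan of a network coding protocol over `Γ`. -/
noncomputable def codingMakespan (Γ : Type) : ℕ := sInf {T | M.CodingMakespanLE Γ T}

/-- The smallest makespan of a routing protocol. -/
noncomputable def routingMakespan : ℕ := sInf {T | M.RoutingMakespanLE T}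

/-- The makespan coding gap.  (It has the value `0` if one of the two kinds of protocols does
not exist, or if the coding makespan is `0`.) -/
noncomputable def makespanGap (Γ : Type) : ℝ :=
  (M.routingMakespan : ℝ) / (M.codingMakespan Γ : ℝ)

end UnicastInstance

/-- A multiple-unicast instance together with a set of cut edges. -/
structure GapInstance extends UnicastInstance where
  cut : Set (Sym2 V)

namespace GapInstance

/-- The standing conditions on gap instances: connected network, cut edges are edges, unit
capacities and demands, and disjoint terminals of different sessions. -/
structure IsGapInstance (I : GapInstance) : Prop where
  connected : I.graph.Connected
  cut_subset : I.cut ⊆ I.graph.edgeSet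
  cap_eq_one : ∀ e ∈ I.graph.edgeSet, I.cap e = 1
  dem_eq_one : ∀ i, I.dem i = 1
  disjoint : ∀ i j, i ≠ j → I.src i ≠ I.src j ∧ I.src i ≠ I.snk j ∧ I.snk i ≠ I.snk j

/-- The gap instance `I` has parameters `(a, b, f, k, m, r, u)`. -/
structure HasParameters (I : GapInstance) (a b f k m : ℕ) (r u : ℝ) : Prop where
  coding : ∀ (Γ : Type) [Finite Γ] [Nontrivial Γ], I.CodingMakespanLE Γ a
  dist : ∀ i, (b : ℕ∞) ≤ (I.graph.deleteEdges I.cut).edist (I.src i) (I.snk i)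
  cut_card : I.cut.ncard = f
  cut_pos : 0 < f
  sessions_card : Nat.card I.ι = k
  edges_card : I.graph.edgeSet.ncard ≤ m
  ratio_sessions : r ≤ (k : ℝ) / (f : ℝ)
  ratio_edges : (m : ℝ) / (f : ℝ) ≤ u

/-- The arcs of the non-cut edges: every non-cut edge gives two anti-parallel arcs. -/
def Arc (I : GapInstance) : Type := {d : I.graph.Dart // d.edge ∉ I.cut}

end GapInstance

/-! ### The base instance -/

/-- Nodes of the base instance with `k` sessions: the sources, the sinks, the hubs `S` and `T`,
and the two inner nodes of the path of three hops from source `i` to sink `j`, for `i ≠ j`. -/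
inductive BaseNode (k : ℕ) : Type
  | source (i : Fin k)
  | sink (i : Fin k)
  | hubS
  | hubT
  | mid (p : {p : Fin k × Fin k // p.1 ≠ p.2}) (second : Bool)

instance (k : ℕ) : Finite (BaseNode k) := by
  let f : (Fin k ⊕ Fin k) ⊕ (Bool ⊕ ({p : Fin k × Fin k // p.1 ≠ p.2} × Bool)) → BaseNode k :=
    Sum.elim (Sum.elim BaseNode.source BaseNode.sink)
      (Sum.elim (fun b => if b then BaseNode.hubS else BaseNode.hubT)
        (fun q => BaseNode.mid q.1 q.2))
  refine Finite.of_surjective f ?_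
  rintro (i | i | _ | _ | ⟨p, b⟩)
  · exact ⟨Sum.inl (Sum.inl i), rfl⟩
  · exact ⟨Sum.inl (Sum.inr i), rfl⟩
  · exact ⟨Sum.inr (Sum.inl true), rfl⟩
  · exact ⟨Sum.inr (Sum.inl false), rfl⟩
  · exact ⟨Sum.inr (Sum.inr (p, b)), rfl⟩

/-- The edges of the base instance, in one direction each. -/
inductive BaseEdge (k : ℕ) : BaseNode k → BaseNode k → Prop
  | source_hub (i : Fin k) : BaseEdge k (.source i) .hubS
  | hub_hub : BaseEdge k .hubS .hubT
  | hub_sink (i : Fin k) : BaseEdge k .hubT (.sink i)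
  | path_first (p : {p : Fin k × Fin k // p.1 ≠ p.2}) :
      BaseEdge k (.source p.1.1) (.mid p false)
  | path_second (p : {p : Fin k × Fin k // p.1 ≠ p.2}) :
      BaseEdge k (.mid p false) (.mid p true)
  | path_third (p : {p : Fin k × Fin k // p.1 ≠ p.2}) :
      BaseEdge k (.mid p true) (.sink p.1.2)

/-- The base gap instance with `k` sessions; its only cut edge is the edge between the hubs. -/
def baseInstance (k : ℕ) : GapInstance where
  V := BaseNode k
  finV := inferInstance
  graph := SimpleGraph.fromRel (BaseEdge k)
  cap := fun _ => 1
  ι := Fin k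
  finι := inferInstance
  src := BaseNode.source
  snk := BaseNode.sink
  dem := fun _ => 1
  cut := {s(BaseNode.hubS, BaseNode.hubT)}

/-! ### The product -/

/-- A colored bipartite graph with edge colors in `A` and session colors in `S`.  By `edge_color`
and `session_color` left nodes have degree `|A|` and see every edge color, and right nodes have
degree `|S|` and see every session color. -/
structure ColoredBipartiteGraph (A S : Type) where
  L : Type
  R : Type
  finL : Finite L
  finR : Finite R
  Adj : L → R → Prop
  χ₁ : L → R → A
  χ₂ : L → R → S
  edge_color : ∀ v a, ∃! w, Adj v w ∧ χ₁ v w = a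
  session_color : ∀ w s, ∃! v, Adj v w ∧ χ₂ v w = s
  same_session : ∀ v w w', Adj v w → Adj v w' → χ₂ v w = χ₂ v w'
  same_edge : ∀ w v v', Adj v w → Adj v' w → χ₁ v w = χ₁ v' w

/-- The underlying graph of a colored bipartite graph. -/
def ColoredBipartiteGraph.graph {A S : Type} (B : ColoredBipartiteGraph A S) :
    SimpleGraph (B.L ⊕ B.R) :=
  SimpleGraph.fromRel fun x y => ∃ v w, x = Sum.inl v ∧ y = Sum.inr w ∧ B.Adj v w

namespace GapInstance

variable (I₁ I₂ : GapInstance) (B : ColoredBipartiteGraph I₁.Arc I₂.ι) (ℓ : ℕ)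

/-- The nodes of the product before merging: the nodes of the copies of the outer instance `I₁`,
the nodes of the copies of the inner instance `I₂`, and, for every copy of every cut edge of
`I₁`, the nodes of a path with `ℓ` edges. -/
abbrev PreNode : Type :=
  (B.L × I₁.V) ⊕ ((B.R × I₂.V) ⊕ (B.L × I₁.cut × Fin (ℓ + 1)))

variable {I₁ I₂ B ℓ}

/-- Node `x` of the outer copy `v`. -/
abbrev PreNode.outer (v : B.L) (x : I₁.V) : PreNode I₁ I₂ B ℓ := Sum.inl (v, x)

/-- Node `p` of the inner copy `w`. -/
abbrev PreNode.inner (w : B.R) (p : I₂.V) : PreNode I₁ I₂ B ℓ := Sum.inr (Sum.inl (w, p))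

/-- Node number `n` of the path that replaces the cut edge `e` in the outer copy `v`. -/
abbrev PreNode.path (v : B.L) (e : I₁.cut) (n : Fin (ℓ + 1)) : PreNode I₁ I₂ B ℓ :=
  Sum.inr (Sum.inr (v, e, n))

variable (I₁ I₂ B ℓ)

/-- The pairs of nodes that are merged.  For every edge `v w` of `B`, the tail and the head of
the arc `χ₁ v w` in the outer copy `v` are merged with the source and the sink of the session
`χ₂ v w` in the inner copy `w`.  The ends of every replacement path are merged with the two ends
of the cut edge (in an arbitrary order, fixed by choice). -/
inductive Merge : PreNode I₁ I₂ B ℓ → PreNode I₁ I₂ B ℓ → Prop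
  | tail (v : B.L) (w : B.R) (h : B.Adj v w) :
      Merge (.outer v (B.χ₁ v w).1.fst) (.inner w (I₂.src (B.χ₂ v w)))
  | head (v : B.L) (w : B.R) (h : B.Adj v w) :
      Merge (.outer v (B.χ₁ v w).1.snd) (.inner w (I₂.snk (B.χ₂ v w)))
  | path_start (v : B.L) (e : I₁.cut) :
      Merge (.outer v (Quot.out e.1).1) (.path v e 0)
  | path_end (v : B.L) (e : I₁.cut) :
      Merge (.outer v (Quot.out e.1).2) (.path v e (Fin.last ℓ))

/-- The edges before merging: those of the inner copies and of the replacement paths.  (Non-cut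
edges of the outer instance are deleted.) -/
inductive PreEdge : PreNode I₁ I₂ B ℓ → PreNode I₁ I₂ B ℓ → Prop
  | inner (w : B.R) (p q : I₂.V) (h : I₂.graph.Adj p q) : PreEdge (.inner w p) (.inner w q)
  | path (v : B.L) (e : I₁.cut) (n n' : Fin (ℓ + 1)) (h : (n' : ℕ) = n + 1) :
      PreEdge (.path v e n) (.path v e n')

/-- The cut edges before merging: the cut edges of the inner copies and the first edge of each
replacement path. -/
inductive PreCut : PreNode I₁ I₂ B ℓ → PreNode I₁ I₂ B ℓ → Prop
  | inner (w : B.R) (p q : I₂.V) (h : s(p, q) ∈ I₂.cut) : PreCut (.inner w p) (.inner w q)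
  | path (v : B.L) (e : I₁.cut) (n n' : Fin (ℓ + 1)) (h : (n : ℕ) = 0) (h' : (n' : ℕ) = 1) :
      PreCut (.path v e n) (.path v e n')

/-- The product of the outer instance `I₁` and the inner instance `I₂` along `B`, where cut edges
of `I₁` are replaced by paths of length `ℓ`.  Its sessions are those of the outer copies. -/
def product : GapInstance where
  V := Quot (Merge I₁ I₂ B ℓ)
  finV := by
    have := I₁.finV
    have := I₂.finV
    have := B.finL
    have := B.finR
    infer_instance
  graph := SimpleGraph.fromRel fun x y =>
    ∃ a b, PreEdge I₁ I₂ B ℓ a b ∧ Quot.mk _ a = x ∧ Quot.mk _ b = y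
  cap := fun _ => 1
  ι := B.L × I₁.ι
  finι := by
    have := I₁.finι
    have := B.finL
    infer_instance
  src := fun i => Quot.mk _ (.outer i.1 (I₁.src i.2))
  snk := fun i => Quot.mk _ (.outer i.1 (I₁.snk i.2))
  dem := fun _ => 1
  cut := {e | ∃ a b, PreCut I₁ I₂ B ℓ a b ∧ e = s(Quot.mk _ a, Quot.mk _ b)}

end GapInstance

/-! Routing is slow when packets are many and the cut is small. If the sources and sinks have
distance at least `b` off the cut, a routing protocol with makespan `T < b` must send every packet
over a cut edge. A cut edge carries at most `2 * T` symbols in `T` rounds, counting both directions,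
so `k / f ≥ 2 * b` is impossible. Coding escapes this: in the base instance the one cut edge carries
the sum of all packets, and each sink subtracts the others, which reach it over three-hop paths.
This takes 3 rounds, against distance 5 off the cut.

The product squares both numbers. For coding, one outer round is simulated in `ℓ` rounds: symbols on
non-cut arcs are packets of inner sessions, and symbols on cut edges travel along replacement paths
(`product_unitCodingMakespanLE`). For distances, every non-cut outer edge becomes a detour of length
at least `b₂` inside an inner copy. Shortcuts through several copies would close a short cycle in
the bipartite graph, so large girth makes the distances multiply (`le_length_of_tree_of_spaces`,
`product_le_edist`).

The ratio of sessions to cut edges survives because of the choice of factors. By double counting,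
`|L| * |A| = |R| * k₂` with `|A| ≤ 2 * m₁ ≤ 2 * u₁ * f₁`, and the inner instance has `k₂ ≥ u₁ * f₂`.
Hence the inner cuts contribute at most `2 * |L| * f₁` cut edges, the replacement paths another `|L|
* f₁`, and an outer ratio of `3 * r` leaves `r`.

The size is controlled by an explicit bipartite graph: a lift of the complete bipartite graph with
voltages in `SL₂(ℤ/q)`. These are reductions of integer matrices to which ping-pong applies, so that
short cycles cannot have trivial voltage (`le_egirth_pingPongLift`). Its size is polynomial in the
number of colors with exponent proportional to the girth. With `n = 2 ^ i` the instances have at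
most `r ^ 2 ^ (16 * n)` sessions, so `log k ≤ 2 ^ (20 * n)` for `r = 2 * 5 ^ n`, while the gap is at
least `(5 / 3) ^ n`: a fixed power of `log k`. -/

/-! ### Distances in tree-like unions of spaces -/

namespace SimpleGraph

/-- Two neighbours of `b` that are joined by a walk avoiding `b` give a cycle through `b`. -/
theorem egirth_le_of_walk_avoiding {β : Type*} {T : SimpleGraph β} {b c c' : β}
    (h : T.Adj b c) (h' : T.Adj b c') (hne : c ≠ c') (q : T.Walk c c') (hb : b ∉ q.support) :
    T.egirth ≤ ((q.length + 2 : ℕ) : ℕ∞) := by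
  classical
  have hb' : b ∉ q.bypass.support := fun hmem => hb (q.support_bypass_subset_support hmem)
  have hcyc : (Walk.cons h'.symm (Walk.cons h q.bypass)).IsCycle := by
    rw [Walk.cons_isCycle_iff]
    refine ⟨(Walk.cons_isPath_iff _ _).2 ⟨q.bypass_isPath, hb'⟩, ?_⟩
    rw [Walk.edges_cons, List.mem_cons, not_or]
    constructor
    · intro heq
      rcases Sym2.eq_iff.1 heq with ⟨h1, -⟩ | ⟨h1, -⟩
      · exact h'.ne h1.symm
      · exact hne h1.symm
    · exact fun hmem => hb' (Walk.snd_mem_support_of_mem_edges _ hmem)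
  refine (egirth_le_length hcyc).trans ?_
  have := q.length_bypass_le_length
  simp only [Walk.length_cons]
  exact_mod_cast by omega

/-- A graph `H` is covered by spaces indexed by the nodes of a graph `T` of large girth.  Spaces
which share a vertex are equal, adjacent, or have a common neighbour containing this vertex; every
edge lies in a space in which it has length at most one; adjacent spaces agree on the distances of
common vertices.  Then short walks in `H` do not beat the distances in the spaces. -/
theorem le_length_of_tree_of_spaces {V β : Type*} {H : SimpleGraph V} {T : SimpleGraph β}
    (mem : β → V → Prop) (d : β → V → V → ℕ∞) (N : ℕ)
    (hgirth : ((2 * N + 1 : ℕ) : ℕ∞) ≤ T.egirth)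
    (hrefl : ∀ b u, d b u u = 0)
    (htri : ∀ b u v w, d b u w ≤ d b u v + d b v w)
    (hadj : ∀ u v, H.Adj u v → ∃ b, mem b u ∧ mem b v ∧ d b u v ≤ 1)
    (hagree : ∀ b c, T.Adj b c → ∀ u v, mem b u → mem b v → mem c u → mem c v →
      d b u v = d c u v)
    (hshare : ∀ b b' u, mem b u → mem b' u → b ≠ b' →
      ∃ c, T.Adj b c ∧ mem c u ∧ (c = b' ∨ T.Adj c b'))
    (n : ℕ) : n < N → ∀ (b : β) (u v : V) (p : H.Walk u v), p.length = n → mem b u → mem b v →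
      d b u v ≤ n := by
  -- A shortest walk that beats the distance in some space is refuted: the spaces of its edges form
  -- a walk in `T` avoiding every violating space, and the girth passes the violation on until it
  -- reaches the space of the first edge.
  induction n using Nat.strong_induction_on with
  | _ n ih =>
  intro hn b₀ u v p hp hu₀ hv₀
  by_contra hviol₀
  have hchoose : ∀ j : ℕ, ∃ b, j < n →
      mem b (p.getVert j) ∧ mem b (p.getVert (j + 1)) ∧
        d b (p.getVert j) (p.getVert (j + 1)) ≤ 1 := by
    intro j
    by_cases hj : j < n
    · obtain ⟨b, hb⟩ := hadj _ _ (p.adj_getVert_succ (hp ▸ hj))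
      exact ⟨b, fun _ => hb⟩
    · exact ⟨b₀, fun h => absurd h hj⟩
  choose e he using hchoose
  have hstart : p.getVert 0 = u := p.getVert_zero
  have hend : p.getVert n = v := hp ▸ p.getVert_length
  have hn0 : 0 < n := by
    rcases Nat.eq_zero_or_pos n with h0 | h0
    · exfalso
      apply hviol₀
      have : u = v := hstart.symm.trans (by rw [← h0]; exact hend)
      subst this
      simp [hrefl]
    · exact h0
  -- a space violating the claim contains no interior vertex of the walk
  have hinterior : ∀ b, mem b u → mem b v → ¬ d b u v ≤ n → ∀ j, 0 < j → j < n →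
      ¬ mem b (p.getVert j) := by
    intro b hu hv hviol j hj0 hjn hmem
    apply hviol
    have h1 := ih j hjn (hjn.trans hn) b _ _ (p.take j)
      (by rw [Walk.take_length, hp]; omega) hu hmem
    have h2 := ih (n - j) (by omega) (by omega) b _ _ (p.drop j)
      (by rw [Walk.drop_length, hp]) hmem hv
    calc d b u v ≤ d b u (p.getVert j) + d b (p.getVert j) v := htri _ _ _ _
      _ ≤ (j : ℕ∞) + ((n - j : ℕ) : ℕ∞) := add_le_add h1 h2
      _ = n := by norm_cast; omega
  -- A violating space is not the space of an edge of the walk: that edge would have an interior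
  -- vertex of the walk as an end, unless it is the whole walk, and then its length is at most one.
  have hedge : ∀ b, mem b u → mem b v → ¬ d b u v ≤ n → ∀ j, j < n → e j ≠ b := by
    rintro b hu hv hviol j hj rfl
    obtain ⟨h1, h2, h3⟩ := he j hj
    have hj0 : j = 0 := by
      by_contra h0
      exact hinterior _ hu hv hviol j (by omega) hj h1
    subst hj0
    have hn1 : n = 1 := by
      by_contra h0
      exact hinterior _ hu hv hviol 1 (by omega) (by omega) h2
    subst hn1
    rw [hstart, hend] at h3
    exact hviol (by exact_mod_cast h3)
  -- The spaces of consecutive edges share an interior vertex, so they are at most two steps apart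
  -- in `T`. A space in between contains that vertex too, hence differs from `b`.
  have hchain : ∀ b, mem b u → mem b v → ¬ d b u v ≤ n → ∀ j, j < n →
      ∃ q : T.Walk (e 0) (e j), q.length ≤ 2 * j ∧ b ∉ q.support := by
    intro b hu hv hviol j
    induction j with
    | zero =>
      intro hj
      refine ⟨Walk.nil, by simp, ?_⟩
      simpa using (hedge b hu hv hviol 0 hj).symm
    | succ j ihj =>
      intro hj
      obtain ⟨q, hq, hbq⟩ := ihj (by omega)
      have hmid := hinterior b hu hv hviol (j + 1) (by omega) hj
      by_cases heq : e j = e (j + 1)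
      · exact ⟨q.copy rfl heq, by rw [Walk.length_copy]; omega, by rwa [Walk.support_copy]⟩
      · obtain ⟨c, hc, hcm, hc'⟩ := hshare _ _ _ (he j (by omega)).2.1 (he (j + 1) hj).1 heq
        have hcb : b ≠ c := by rintro rfl; exact hmid hcm
        rcases hc' with rfl | hc'
        · refine ⟨q.concat hc, by rw [Walk.length_concat]; omega, ?_⟩
          simp [Walk.support_concat, hbq, hcb]
        · refine ⟨(q.concat hc).concat hc', by simp only [Walk.length_concat]; omega, ?_⟩
          have := (hedge b hu hv hviol (j + 1) hj).symm
          simp [Walk.support_concat, hbq, hcb, this]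
  -- violation spreads from a space to its neighbour towards the first edge of the walk
  have hspread : ∀ b c, mem b u → mem b v → ¬ d b u v ≤ n → T.Adj b c → mem c u →
      (c = e 0 ∨ T.Adj c (e 0)) → mem c v ∧ ¬ d c u v ≤ n := by
    intro b c hu hv hviol hbc hcu hc
    have hlast : n - 1 < n := by omega
    have hlastv : mem (e (n - 1)) v := by
      have := (he (n - 1) hlast).2.1
      rwa [Nat.sub_add_cancel hn0, hend] at this
    obtain ⟨c', hbc', hcv', hc'⟩ :=
      hshare b (e (n - 1)) v hv hlastv (hedge b hu hv hviol _ hlast).symm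
    obtain ⟨q, hq, hbq⟩ := hchain b hu hv hviol (n - 1) hlast
    obtain ⟨q₁, hq₁, hbq₁⟩ : ∃ q₁ : T.Walk c (e (n - 1)),
        q₁.length ≤ 2 * (n - 1) + 1 ∧ b ∉ q₁.support := by
      rcases hc with rfl | hc
      · exact ⟨q, by omega, hbq⟩
      · exact ⟨Walk.cons hc q, by rw [Walk.length_cons]; omega, by simp [hbq, hbc.ne]⟩
    obtain ⟨q₂, hq₂, hbq₂⟩ : ∃ q₂ : T.Walk c c',
        q₂.length ≤ 2 * (n - 1) + 2 ∧ b ∉ q₂.support := by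
      rcases hc' with rfl | hc'
      · exact ⟨q₁, by omega, hbq₁⟩
      · exact ⟨q₁.concat hc'.symm, by rw [Walk.length_concat]; omega,
          by simp [Walk.support_concat, hbq₁, hbc'.ne]⟩
    -- Otherwise `b` lies on a cycle of length at most `2 * n + 2 ≤ 2 * N`.
    have hcc : c = c' := by
      by_contra hne
      have h1 := hgirth.trans (egirth_le_of_walk_avoiding hbc hbc' hne q₂ hbq₂)
      have h2 : 2 * N + 1 ≤ q₂.length + 2 := by exact_mod_cast h1
      omega
    subst hcc
    exact ⟨hcv', by rwa [← hagree b c hbc u v hu hv hcu hcv']⟩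
  have he0 : mem (e 0) u := by
    have := (he 0 hn0).1
    rwa [hstart] at this
  obtain ⟨c, hbc, hcu, hc⟩ := hshare b₀ (e 0) u hu₀ he0 (hedge b₀ hu₀ hv₀ hviol₀ 0 hn0).symm
  obtain ⟨hcv, hcviol⟩ := hspread b₀ c hu₀ hv₀ hviol₀ hbc hcu hc
  -- After at most two spreading steps the space of the first edge is itself violating, which
  -- `hedge` excludes.
  rcases hc with rfl | hc
  · exact hedge _ hcu hcv hcviol 0 hn0 rfl
  · obtain ⟨h1, h2⟩ := hspread c (e 0) hcu hcv hcviol hc he0 (Or.inl rfl)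
    exact hedge _ he0 h1 h2 0 hn0 rfl

end SimpleGraph

/-! ### Colored bipartite graphs of large girth -/

namespace ColoredBipartiteGraph

variable {A S : Type}

theorem graph_adj_inl_inr (B : ColoredBipartiteGraph A S) {v : B.L} {w : B.R} :
    B.graph.Adj (Sum.inl v) (Sum.inr w) ↔ B.Adj v w := by
  simp [graph]

theorem graph_adj_inr_inl (B : ColoredBipartiteGraph A S) {v : B.L} {w : B.R} :
    B.graph.Adj (Sum.inr w) (Sum.inl v) ↔ B.Adj v w := by
  simp [graph]

theorem not_graph_adj_inl_inl (B : ColoredBipartiteGraph A S) {v v' : B.L} :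
    ¬ B.graph.Adj (Sum.inl v) (Sum.inl v') := by
  simp [graph]

theorem not_graph_adj_inr_inr (B : ColoredBipartiteGraph A S) {w w' : B.R} :
    ¬ B.graph.Adj (Sum.inr w) (Sum.inr w') := by
  simp [graph]

/-- Double counting of the edges. -/
theorem card_left_mul_card (B : ColoredBipartiteGraph A S) :
    Nat.card B.L * Nat.card A = Nat.card B.R * Nat.card S := by
  choose f hf hf' using B.edge_color
  choose g hg hg' using B.session_color
  rw [← Nat.card_prod, ← Nat.card_prod]
  refine Nat.card_congr
    ⟨fun p => (f p.1 p.2, B.χ₂ p.1 (f p.1 p.2)), fun p => (g p.1 p.2, B.χ₁ (g p.1 p.2) p.1), ?_, ?_⟩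
  · rintro ⟨v, a⟩
    have h : g (f v a) (B.χ₂ v (f v a)) = v := (hg' _ _ _ ⟨(hf v a).1, rfl⟩).symm
    simp [h, (hf v a).2]
  · rintro ⟨w, s⟩
    have h : f (g w s) (B.χ₁ (g w s) w) = w := (hf' _ _ _ ⟨(hg w s).1, rfl⟩).symm
    simp [h, (hg w s).2]

/-- The restriction of a colored bipartite graph to the connected component of a left node. -/
def component (B : ColoredBipartiteGraph A S) (v₀ : B.L) : ColoredBipartiteGraph A S where
  L := {v : B.L // B.graph.Reachable (Sum.inl v₀) (Sum.inl v)}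
  R := {w : B.R // B.graph.Reachable (Sum.inl v₀) (Sum.inr w)}
  finL := by have := B.finL; infer_instance
  finR := by have := B.finR; infer_instance
  Adj v w := B.Adj v w
  χ₁ v w := B.χ₁ v w
  χ₂ v w := B.χ₂ v w
  edge_color := by
    rintro ⟨v, hv⟩ a
    obtain ⟨w, hw, huniq⟩ := B.edge_color v a
    refine ⟨⟨w, hv.trans (B.graph_adj_inl_inr.2 hw.1).reachable⟩, hw, ?_⟩
    rintro ⟨w', hw'⟩ h
    exact Subtype.ext (huniq w' h)
  session_color := by
    rintro ⟨w, hw⟩ s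
    obtain ⟨v, hv, huniq⟩ := B.session_color w s
    refine ⟨⟨v, hw.trans (B.graph_adj_inr_inl.2 hv.1).reachable⟩, hv, ?_⟩
    rintro ⟨v', hv'⟩ h
    exact Subtype.ext (huniq v' h)
  same_session v w w' h h' := B.same_session v w w' h h'
  same_edge w v v' h h' := B.same_edge w v v' h h'

theorem egirth_le_component (B : ColoredBipartiteGraph A S) (v₀ : B.L) :
    B.graph.egirth ≤ (B.component v₀).graph.egirth := by
  apply SimpleGraph.IsContained.egirth_le
  refine ⟨⟨⟨Sum.map Subtype.val Subtype.val, ?_⟩, ?_⟩⟩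
  · rintro (v | w) (v' | w') h
    · exact absurd h (not_graph_adj_inl_inl _)
    · exact B.graph_adj_inl_inr.2 ((B.component v₀).graph_adj_inl_inr.1 h)
    · exact B.graph_adj_inr_inl.2 ((B.component v₀).graph_adj_inr_inl.1 h)
    · exact absurd h (not_graph_adj_inr_inr _)
  · exact Sum.map_injective.2 ⟨Subtype.val_injective, Subtype.val_injective⟩

/-- Gap instances must be connected, and products inherit this from the bipartite graph; this is why
lifts are cut down to a component. -/
theorem component_connected (B : ColoredBipartiteGraph A S) (v₀ : B.L) :
    (B.component v₀).graph.Connected := by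
  set v₁ : (B.component v₀).L := ⟨v₀, SimpleGraph.Reachable.refl _⟩
  have key : ∀ x : B.L ⊕ B.R, B.graph.Reachable (Sum.inl v₀) x →
      ∀ y : (B.component v₀).L ⊕ (B.component v₀).R, Sum.map Subtype.val Subtype.val y = x →
        (B.component v₀).graph.Reachable (Sum.inl v₁) y := by
    intro x hx
    rw [SimpleGraph.reachable_iff_reflTransGen] at hx
    induction hx with
    | refl =>
      rintro (y | y) hy
      · have : y = v₁ := Subtype.ext (Sum.inl.inj hy)
        rw [this]
      · exact absurd hy (by rintro ⟨⟩)
    | @tail x x' hx hadj ih =>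
      rw [← SimpleGraph.reachable_iff_reflTransGen] at hx
      rintro (y | y) rfl
      · rcases x with x | x
        · exact absurd hadj (not_graph_adj_inl_inl _)
        · exact (ih (Sum.inr ⟨x, hx⟩) rfl).trans
            ((B.component v₀).graph_adj_inr_inl.2 (B.graph_adj_inr_inl.1 hadj)).reachable
      · rcases x with x | x
        · exact (ih (Sum.inl ⟨x, hx⟩) rfl).trans
            ((B.component v₀).graph_adj_inl_inr.2 (B.graph_adj_inl_inr.1 hadj)).reachable
        · exact absurd hadj (not_graph_adj_inr_inr _)
  have : Nonempty ((B.component v₀).L ⊕ (B.component v₀).R) := ⟨Sum.inl v₁⟩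
  refine ⟨fun x y => ?_⟩
  have h : ∀ y, (B.component v₀).graph.Reachable (Sum.inl v₁) y := by
    rintro (⟨y, hy⟩ | ⟨y, hy⟩)
    · exact key _ hy _ rfl
    · exact key _ hy _ rfl
  exact (h x).symm.trans (h y)

/-- The lift of the complete bipartite graph on `S` and `A` with voltages `h` in the group `H`. -/
def lift {H : Type} [Group H] [Finite H] [Finite A] [Finite S] (h : S → A → H) :
    ColoredBipartiteGraph A S where
  L := S × H
  R := A × H
  finL := inferInstance
  finR := inferInstance
  Adj v w := w.2 = v.2 * h v.1 w.1
  χ₁ _ w := w.1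
  χ₂ v _ := v.1
  edge_color v a := ⟨(a, v.2 * h v.1 a), ⟨rfl, rfl⟩, by rintro ⟨_, _⟩ ⟨h, rfl⟩; simpa using h⟩
  session_color w s := ⟨(s, w.2 * (h s w.1)⁻¹), ⟨by simp, rfl⟩, by
    rintro ⟨_, _⟩ ⟨h, rfl⟩
    simp [h]⟩
  same_session _ _ _ _ _ := rfl
  same_edge _ _ _ _ _ := rfl

end ColoredBipartiteGraph

/-! #### A free family of integer matrices -/

/-- The conjugates `aⁿ b a⁻ⁿ` of `b = (1 0; 2 1)` by the powers of `a = (1 2; 0 1)`. -/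
def pingPongMatrix (R : Type) [CommRing R] (n : R) : Matrix.SpecialLinearGroup (Fin 2) R :=
  ⟨!![1 + 4 * n, -8 * n ^ 2; 2, 1 - 4 * n], by rw [Matrix.det_fin_two_of]; ring⟩

/-- A vector that is not attracted by index `n` is mapped into the domain of attraction of the
ping-pong matrix with index `n` and of its inverse. -/
theorem pingPong_attract {n x y ε : ℤ} (hε : ε = 1 ∨ ε = -1) (h : |y| < |x - 2 * n * y|) :
    |(x + ε * (4 * n * x - 8 * n ^ 2 * y)) - 2 * n * (y + ε * (2 * x - 4 * n * y))| <
      |y + ε * (2 * x - 4 * n * y)| := by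
  -- The matrix fixes the linear form `x - 2 * n * y` and adds `± 2` times that form to `y`, so a
  -- form larger than `y` is overtaken.
  have h4 : x + ε * (4 * n * x - 8 * n ^ 2 * y) - 2 * n * (y + ε * (2 * x - 4 * n * y))
      = x - 2 * n * y := by ring
  have h5 : y + ε * (2 * x - 4 * n * y) = y + ε * (2 * (x - 2 * n * y)) := by ring
  rw [h4, h5]
  have h6 : |ε * (2 * (x - 2 * n * y))| = 2 * |x - 2 * n * y| := by
    rcases hε with rfl | rfl <;> simp [abs_mul]
  have h7 := abs_sub_abs_le_abs_sub (ε * (2 * (x - 2 * n * y))) (-y)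
  rw [abs_neg, h6, sub_neg_eq_add, add_comm _ y] at h7
  linarith

/-- The domains of attraction for different indices are disjoint. -/
theorem pingPong_repel {n m x y : ℤ} (hnm : n ≠ m) (h : |x - 2 * m * y| < |y|) :
    |y| < |x - 2 * n * y| := by
  have h0 : 1 ≤ |n - m| := Int.one_le_abs (sub_ne_zero.2 hnm)
  -- The forms for `n` and `m` differ by `2 * (n - m) * y`, of size at least `2 * |y|`; if one is
  -- below `|y|`, the other is above.
  have h2 : |2 * (n - m) * y| ≤ |x - 2 * n * y| + |x - 2 * m * y| := by
    have := abs_sub (x - 2 * m * y) (x - 2 * n * y)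
    calc |2 * (n - m) * y| = |(x - 2 * m * y) - (x - 2 * n * y)| := by ring_nf
      _ ≤ _ := by linarith
  have h3 : |2 * (n - m) * y| = 2 * |n - m| * |y| := by rw [abs_mul, abs_mul]; simp
  nlinarith [abs_nonneg y]

/-- Since `8 * n ^ 2 + 4 * n + 3 ≤ 8 * (n + 1) ^ 2 ≤ 8 * d ^ 2`, one factor `8 * d ^ 2` per step
bounds the integer vector; for short walks it then stays below the modulus. -/
theorem pingPong_growth {n x y ε K : ℤ} {d : ℕ} (hε : ε = 1 ∨ ε = -1) (hn : 0 ≤ n) (hnd : n < d)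
    (hx : |x| ≤ K) (hy : |y| ≤ K) :
    |x + ε * (4 * n * x - 8 * n ^ 2 * y)| ≤ 8 * d ^ 2 * K ∧
      |y + ε * (2 * x - 4 * n * y)| ≤ 8 * d ^ 2 * K := by
  have hK : 0 ≤ K := (abs_nonneg x).trans hx
  have hε' : |ε| = 1 := by rcases hε with rfl | rfl <;> simp
  have hd : n + 1 ≤ d := hnd
  have hnn : 0 ≤ n ^ 2 := sq_nonneg n
  have h1 : 8 * n ^ 2 + 4 * n + 3 ≤ 8 * (d : ℤ) ^ 2 := by nlinarith
  have hnx : |n| = n := abs_of_nonneg hn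
  constructor
  · calc |x + ε * (4 * n * x - 8 * n ^ 2 * y)|
        ≤ |x| + |ε * (4 * n * x - 8 * n ^ 2 * y)| := abs_add_le _ _
      _ = |x| + |4 * n * x - 8 * n ^ 2 * y| := by rw [abs_mul ε, hε', one_mul]
      _ ≤ |x| + (|4 * n * x| + |8 * n ^ 2 * y|) := by gcongr; exact abs_sub _ _
      _ = |x| + (4 * n * |x| + 8 * n ^ 2 * |y|) := by simp [abs_mul, hnx]
      _ ≤ K + (4 * n * K + 8 * n ^ 2 * K) := by gcongr
      _ = (8 * n ^ 2 + 4 * n + 1) * K := by ring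
      _ ≤ 8 * d ^ 2 * K := by gcongr; linarith
  · calc |y + ε * (2 * x - 4 * n * y)|
        ≤ |y| + |ε * (2 * x - 4 * n * y)| := abs_add_le _ _
      _ = |y| + |2 * x - 4 * n * y| := by rw [abs_mul ε, hε', one_mul]
      _ ≤ |y| + (|2 * x| + |4 * n * y|) := by gcongr; exact abs_sub _ _
      _ = |y| + (2 * |x| + 4 * n * |y|) := by simp [abs_mul, hnx]
      _ ≤ K + (2 * K + 4 * n * K) := by gcongr
      _ = (4 * n + 3) * K := by ring
      _ ≤ 8 * d ^ 2 * K := by gcongr; linarith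

/-! ### Girth and size of the ping-pong lift. -/

namespace ColoredBipartiteGraph

variable {A S : Type} [Finite A] [Finite S]

/-- The lift of the complete bipartite graph by ping-pong matrices modulo `q`. -/
def pingPongLift (q : ℕ) [NeZero q] (idx : S → A → ℕ) : ColoredBipartiteGraph A S :=
  lift fun s a => pingPongMatrix (ZMod q) (idx s a)

/-- The group coordinate of a node of a lift. -/
def groupCoord {q : ℕ} [NeZero q] (idx : S → A → ℕ) :
    (pingPongLift q idx).L ⊕ (pingPongLift q idx).R → Matrix.SpecialLinearGroup (Fin 2) (ZMod q)
  | Sum.inl v => v.2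
  | Sum.inr w => w.2

/-- The index of the matrix on an edge of a lift. -/
def edgeIndex {q : ℕ} [NeZero q] (idx : S → A → ℕ) :
    (pingPongLift q idx).L ⊕ (pingPongLift q idx).R →
      (pingPongLift q idx).L ⊕ (pingPongLift q idx).R → ℕ
  | Sum.inl v, Sum.inr w => idx v.1 w.1
  | Sum.inr w, Sum.inl v => idx v.1 w.1
  | _, _ => 0

/-- The voltage is `1 + N` with `N ^ 2 = 0`, so its inverse is `1 - N`; the sign `ε` records the
direction in which the edge is traversed. Only the first column is followed, through integer
representatives, because ping-pong makes no sense modulo `q`. -/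
theorem pingPongLift_step {q : ℕ} [NeZero q] (idx : S → A → ℕ)
    {u v : (pingPongLift q idx).L ⊕ (pingPongLift q idx).R}
    (h : (pingPongLift q idx).graph.Adj u v) :
    ∃ ε : ℤ, (ε = 1 ∨ ε = -1) ∧ ∀ (M : Matrix.SpecialLinearGroup (Fin 2) (ZMod q)) (x y : ℤ),
      M.1 0 0 = x → M.1 1 0 = y →
      ((groupCoord idx u)⁻¹ * groupCoord idx v * M).1 0 0 =
        ((x + ε * (4 * edgeIndex idx u v * x - 8 * edgeIndex idx u v ^ 2 * y) : ℤ) : ZMod q) ∧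
      ((groupCoord idx u)⁻¹ * groupCoord idx v * M).1 1 0 =
        ((y + ε * (2 * x - 4 * edgeIndex idx u v * y) : ℤ) : ZMod q) := by
  rcases u with u | u <;> rcases v with v | v
  · exact absurd h (not_graph_adj_inl_inl _)
  · have h' : v.2 = u.2 * pingPongMatrix (ZMod q) (idx u.1 v.1) :=
      (pingPongLift q idx).graph_adj_inl_inr.1 h
    refine ⟨1, Or.inl rfl, fun M x y hx hy => ?_⟩
    have h1 : (groupCoord idx (Sum.inl u))⁻¹ *
        groupCoord idx (Sum.inr v) =
        pingPongMatrix (ZMod q) (idx u.1 v.1) := by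
      rw [inv_mul_eq_iff_eq_mul]
      exact h'
    rw [h1]
    simp only [Matrix.SpecialLinearGroup.coe_mul, Matrix.mul_apply, Fin.sum_univ_two, hx, hy,
      edgeIndex]
    simp only [pingPongMatrix, Matrix.of_apply, Matrix.cons_val', Matrix.cons_val_zero,
      Matrix.cons_val_one]
    push_cast
    constructor <;> ring
  · have h' : u.2 = v.2 * pingPongMatrix (ZMod q) (idx v.1 u.1) :=
      (pingPongLift q idx).graph_adj_inr_inl.1 h
    refine ⟨-1, Or.inr rfl, fun M x y hx hy => ?_⟩
    have h1 : (groupCoord idx (Sum.inr u))⁻¹ *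
        groupCoord idx (Sum.inl v) =
        (pingPongMatrix (ZMod q) (idx v.1 u.1))⁻¹ := by
      rw [inv_mul_eq_iff_eq_mul, eq_mul_inv_iff_mul_eq]
      exact h'.symm
    rw [h1]
    simp only [Matrix.SpecialLinearGroup.coe_mul, Matrix.mul_apply, Fin.sum_univ_two, hx, hy,
      edgeIndex, Matrix.SpecialLinearGroup.coe_inv]
    simp only [pingPongMatrix, Matrix.adjugate_fin_two_of, Matrix.of_apply, Matrix.cons_val',
      Matrix.cons_val_zero, Matrix.cons_val_one]
    push_cast
    constructor <;> ring
  · exact absurd h (not_graph_adj_inr_inr _)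

theorem edgeIndex_comm {q : ℕ} [NeZero q] (idx : S → A → ℕ)
    (u v : (pingPongLift q idx).L ⊕ (pingPongLift q idx).R) :
    edgeIndex idx u v = edgeIndex idx v u := by
  rcases u with u | u <;> rcases v with v | v <;> rfl

theorem edgeIndex_lt {q d : ℕ} [NeZero q] {idx : S → A → ℕ} (hd : ∀ s a, idx s a < d)
    {u v : (pingPongLift q idx).L ⊕ (pingPongLift q idx).R}
    (h : (pingPongLift q idx).graph.Adj u v) : edgeIndex idx u v < d := by
  rcases u with u | u <;> rcases v with v | v
  · exact absurd h (not_graph_adj_inl_inl _)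
  · exact hd _ _
  · exact hd _ _
  · exact absurd h (not_graph_adj_inr_inr _)

theorem edgeIndex_injective {q : ℕ} [NeZero q] {idx : S → A → ℕ}
    (hinj : ∀ s a s' a', idx s a = idx s' a' → s = s' ∧ a = a')
    {u v v' : (pingPongLift q idx).L ⊕ (pingPongLift q idx).R}
    (h : (pingPongLift q idx).graph.Adj u v) (h' : (pingPongLift q idx).graph.Adj u v')
    (heq : edgeIndex idx u v = edgeIndex idx u v') : v = v' := by
  rcases u with u | u <;> rcases v with v | v
  · exact absurd h (not_graph_adj_inl_inl _)
  · rcases v' with v' | v'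
    · exact absurd h' (not_graph_adj_inl_inl _)
    · have h1 := (hinj _ _ _ _ heq).2
      have h2 := (pingPongLift q idx).graph_adj_inl_inr.1 h
      have h3 := (pingPongLift q idx).graph_adj_inl_inr.1 h'
      exact congrArg Sum.inr (((pingPongLift q idx).edge_color u v.1).unique ⟨h2, rfl⟩ ⟨h3, h1.symm⟩)
  · rcases v' with v' | v'
    · have h1 := (hinj _ _ _ _ heq).1
      have h2 := (pingPongLift q idx).graph_adj_inr_inl.1 h
      have h3 := (pingPongLift q idx).graph_adj_inr_inl.1 h'
      exact congrArg Sum.inl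
        (((pingPongLift q idx).session_color u v.1).unique ⟨h2, rfl⟩ ⟨h3, h1.symm⟩)
    · exact absurd h' (not_graph_adj_inr_inr _)
  · exact absurd h (not_graph_adj_inr_inr _)

/-- The matrix along a trail, read off an integer vector on which ping-pong is played. -/
theorem pingPongLift_trail {q d : ℕ} [NeZero q] {idx : S → A → ℕ} (hd : ∀ s a, idx s a < d)
    (hinj : ∀ s a s' a', idx s a = idx s' a' → s = s' ∧ a = a')
    {u v : (pingPongLift q idx).L ⊕ (pingPongLift q idx).R}
    (p : (pingPongLift q idx).graph.Walk u v) (hp : p.IsTrail) :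
    ∃ x y : ℤ, ((groupCoord idx u)⁻¹ * groupCoord idx v).1 0 0 = x ∧
      ((groupCoord idx u)⁻¹ * groupCoord idx v).1 1 0 = y ∧
      |x| ≤ (8 * d ^ 2) ^ p.length ∧ |y| ≤ (8 * d ^ 2) ^ p.length ∧
      (p.length ≠ 0 → y ≠ 0) ∧
      ∀ t, (pingPongLift q idx).graph.Adj u t → s(u, t) ∉ p.edges →
        |y| < |x - 2 * edgeIndex idx u t * y| := by
  induction p with
  -- The first column `(1, 0)` of the identity is attracted by no index.
  | nil => exact ⟨1, 0, by simp, by simp, by simp, by simp, by simp, by simp⟩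
  | @cons u v w h p ih =>
    rw [SimpleGraph.Walk.isTrail_cons] at hp
    obtain ⟨x, y, hx, hy, hxK, hyK, -, hrep⟩ := ih hp.1
    obtain ⟨ε, hε, hstep⟩ := pingPongLift_step idx h
    obtain ⟨h1, h2⟩ := hstep _ x y hx hy
    -- The new edge does not occur in the rest of the trail, so its index does not attract the
    -- current vector. The step makes it attracted by this index, hence repelled by those of all
    -- other edges at `u`.
    have hrep' := hrep u h.symm (by rw [Sym2.eq_swap]; exact hp.2)
    rw [edgeIndex_comm] at hrep'
    have hatt := pingPong_attract hε hrep'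
    have hgrow := pingPong_growth hε (Int.natCast_nonneg _)
      (by exact_mod_cast edgeIndex_lt hd h) hxK hyK
    have hmul : (groupCoord idx u)⁻¹ *
        groupCoord idx v *
        ((groupCoord idx v)⁻¹ *
          groupCoord idx w) =
        (groupCoord idx u)⁻¹ *
          groupCoord idx w := by group
    rw [hmul] at h1 h2
    refine ⟨_, _, h1, h2, ?_, ?_, ?_, ?_⟩
    · rw [SimpleGraph.Walk.length_cons, pow_succ' _ p.length]
      exact hgrow.1
    · rw [SimpleGraph.Walk.length_cons, pow_succ' _ p.length]
      exact hgrow.2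
    · intro _ h0
      rw [h0] at hatt
      simp only [abs_zero] at hatt
      exact absurd hatt (not_lt.2 (abs_nonneg _))
    · intro t ht htp
      refine pingPong_repel ?_ hatt
      intro heq
      have : t = v := edgeIndex_injective hinj ht h (by exact_mod_cast heq)
      subst this
      simp at htp

/-- The matrix along a closed walk is the identity, so its lower left entry vanishes modulo `q`.
Along a cycle shorter than `g` this entry is represented by an integer that is nonzero by ping-pong
and smaller than `q` by the growth bound. -/
theorem le_egirth_pingPongLift {d g : ℕ} (hd0 : 0 < d) {idx : S → A → ℕ}
    (hd : ∀ s a, idx s a < d) (hinj : ∀ s a s' a', idx s a = idx s' a' → s = s' ∧ a = a') :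
    (g : ℕ∞) ≤ (pingPongLift ((8 * d ^ 2) ^ g + 2) idx).graph.egirth := by
  rw [SimpleGraph.le_egirth]
  intro a p hp
  by_contra hlt
  have hlt' : p.length < g := by
    rw [not_le] at hlt
    exact_mod_cast hlt
  obtain ⟨x, y, -, hy, -, hyK, hy0, -⟩ := pingPongLift_trail hd hinj p hp.isTrail
  apply hy0 (by have := hp.three_le_length; omega)
  rw [inv_mul_cancel] at hy
  have hdvd : (((8 * d ^ 2) ^ g + 2 : ℕ) : ℤ) ∣ y := by
    rw [← ZMod.intCast_zmod_eq_zero_iff_dvd]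
    rw [← hy]
    simp
  apply Int.eq_zero_of_abs_lt_dvd hdvd
  have h1 : (8 * (d : ℤ) ^ 2) ^ p.length ≤ (8 * (d : ℤ) ^ 2) ^ g := by
    apply pow_le_pow_right₀ _ hlt'.le
    have : (1 : ℤ) ≤ d := by exact_mod_cast hd0
    nlinarith
  push_cast
  linarith

/-- Connected colored bipartite graphs of large girth and moderate size. -/
theorem exists_large_girth (A S : Type) [Finite A] [Finite S] [Nonempty A] [Nonempty S] (g : ℕ) :
    ∃ B : ColoredBipartiteGraph A S, (g : ℕ∞) ≤ B.graph.egirth ∧ B.graph.Connected ∧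
      Nat.card B.L ≤ Nat.card S * ((8 * (Nat.card A * Nat.card S) ^ 2) ^ g + 2) ^ 4 ∧
      Nat.card B.R ≤ Nat.card A * ((8 * (Nat.card A * Nat.card S) ^ 2) ^ g + 2) ^ 4 := by
  set d := Nat.card A * Nat.card S with hd
  have hd0 : 0 < d := Nat.mul_pos Nat.card_pos Nat.card_pos
  set q := (8 * d ^ 2) ^ g + 2 with hq
  let e : A × S ≃ Fin d := (Finite.equivFin (A × S)).trans (finCongr (by rw [Nat.card_prod]))
  let idx : S → A → ℕ := fun s a => e (a, s)
  have hlt : ∀ s a, idx s a < d := fun s a => (e (a, s)).2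
  have hinj : ∀ s a s' a', idx s a = idx s' a' → s = s' ∧ a = a' := by
    intro s a s' a' h
    have := e.injective (Fin.ext h)
    simp only [Prod.mk.injEq] at this
    exact ⟨this.2, this.1⟩
  have hcard : Nat.card (Matrix.SpecialLinearGroup (Fin 2) (ZMod q)) ≤ q ^ 4 := by
    calc Nat.card (Matrix.SpecialLinearGroup (Fin 2) (ZMod q))
        ≤ Nat.card (Matrix (Fin 2) (Fin 2) (ZMod q)) :=
          Nat.card_le_card_of_injective _ Subtype.val_injective
      _ = q ^ 4 := by
          simp [Matrix, ← pow_mul]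
  obtain ⟨s₀⟩ := ‹Nonempty S›
  let B := pingPongLift q idx
  let v₀ : B.L := (s₀, 1)
  have hfL := B.finL
  have hfR := B.finR
  refine ⟨B.component v₀, (le_egirth_pingPongLift hd0 hlt hinj).trans (B.egirth_le_component v₀),
    B.component_connected v₀, ?_, ?_⟩
  · calc Nat.card (B.component v₀).L ≤ Nat.card B.L :=
          Nat.card_le_card_of_injective _ Subtype.val_injective
      _ = Nat.card S * Nat.card (Matrix.SpecialLinearGroup (Fin 2) (ZMod q)) := Nat.card_prod _ _
      _ ≤ _ := Nat.mul_le_mul_left _ hcard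
  · calc Nat.card (B.component v₀).R ≤ Nat.card B.R :=
          Nat.card_le_card_of_injective _ Subtype.val_injective
      _ = Nat.card A * Nat.card (Matrix.SpecialLinearGroup (Fin 2) (ZMod q)) := Nat.card_prod _ _
      _ ≤ _ := Nat.mul_le_mul_left _ hcard

end ColoredBipartiteGraph

/-! ### Routing -/

/-- The factor 2 counts the two directions of an edge: the Boolean records whether the pair is the
representative of its edge chosen by `Quot.out`. -/
theorem Sym2.ncard_pairs_le {V : Type*} [Finite V] (X : Set (Sym2 V)) :
    {p : V × V | s(p.1, p.2) ∈ X}.ncard ≤ 2 * X.ncard := by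
  classical
  have hout : ∀ p : V × V, s((Quot.out s(p.1, p.2)).1, (Quot.out s(p.1, p.2)).2) = s(p.1, p.2) :=
    fun p => Quot.out_eq (s(p.1, p.2))
  calc {p : V × V | s(p.1, p.2) ∈ X}.ncard
      ≤ (X ×ˢ (Set.univ : Set Bool)).ncard := by
        refine Set.ncard_le_ncard_of_injOn
          (fun p => (s(p.1, p.2), decide (p = Quot.out s(p.1, p.2)))) ?_ ?_ (Set.toFinite _)
        · intro p hp
          exact ⟨hp, trivial⟩
        · rintro p - p' - h
          simp only [Prod.mk.injEq, decide_eq_decide] at h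
          obtain ⟨h1, h2⟩ := h
          rw [h1] at h2
          by_cases h3 : p' = Quot.out s(p'.1, p'.2)
          · exact (h2.2 h3).trans h3.symm
          · have h4 : p ≠ Quot.out s(p'.1, p'.2) := fun h => h3 (h2.1 h)
            have h5 := hout p'
            rcases Sym2.eq_iff.1 h5 with h | h
            · exact absurd (Prod.ext h.1.symm h.2.symm) h3
            rcases Sym2.eq_iff.1 (h5.trans h1.symm) with h' | h'
            · exact absurd (Prod.ext h'.1.symm h'.2.symm) h4
            exact Prod.ext (h'.2.symm.trans h.2) (h'.1.symm.trans h.1)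
    _ = 2 * X.ncard := by rw [Set.ncard_prod]; simp [mul_comm]

namespace GapInstance

theorem card_arc_le (I : GapInstance) : Nat.card I.Arc ≤ 2 * I.graph.edgeSet.ncard := by
  have := I.finV
  refine le_trans ?_ (Sym2.ncard_pairs_le I.graph.edgeSet)
  rw [← Nat.card_coe_set_eq]
  refine Nat.card_le_card_of_injective
    (fun a : I.Arc => (⟨(a.1.fst, a.1.snd), a.1.adj⟩ :
      {p : I.V × I.V | s(p.1, p.2) ∈ I.graph.edgeSet})) ?_
  intro a a' h
  exact Subtype.ext (SimpleGraph.Dart.ext _ _ (congrArg Subtype.val h))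

variable {I : GapInstance}

/-- A sub-packet which reaches a node without using a cut edge has to travel around the cut. -/
theorem edist_le_of_holds {P : I.RoutingSchedule}
    (hP : UnicastInstance.IsRoutingProtocol P) (t : ℕ) (v : I.V) (p : I.SubPacket)
    (h : UnicastInstance.Holds P v t p)
    (hcut : ∀ r < t, ∀ u w, s(u, w) ∈ I.cut → ∀ j, P r u w j ≠ some p) :
    (I.graph.deleteEdges I.cut).edist (I.src p.1) v ≤ t := by
  induction t using Nat.strong_induction_on generalizing v with
  | _ t ih =>
  rcases h with rfl | ⟨r, hr, u, hadj, j, hj⟩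
  · simp
  · have h1 := ih r hr u (hP r u v hadj j p hj)
      (fun r' hr' => hcut r' (hr'.trans hr))
    have h2 : (I.graph.deleteEdges I.cut).edist u v ≤ 1 := by
      rw [SimpleGraph.edist_le_one_iff_adj_or_eq]
      left
      rw [SimpleGraph.deleteEdges_adj]
      exact ⟨hadj, fun hc => hcut r hr u v hc j hj⟩
    calc (I.graph.deleteEdges I.cut).edist (I.src p.1) v
        ≤ _ := SimpleGraph.edist_triangle
      _ ≤ (r : ℕ∞) + 1 := add_le_add h1 h2
      _ ≤ t := by exact_mod_cast hr

/-- Fast routing protocols send every packet through the cut. -/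
theorem card_sessions_le_of_routing (hI : I.IsGapInstance) {b T : ℕ}
    (hdist : ∀ i, (b : ℕ∞) ≤ (I.graph.deleteEdges I.cut).edist (I.src i) (I.snk i))
    (hT : I.RoutingMakespanLE T) (hTb : T < b) : Nat.card I.ι ≤ T * (2 * I.cut.ncard) := by
  have := I.finV
  obtain ⟨P, τ, hP, hτ, hτT⟩ := hT
  -- Each session occupies a slot, that is, a round and a direction of a cut edge. Without one, its
  -- packet would have walked around the cut, which takes `b > T` rounds. Unit capacity makes slots
  -- of different sessions distinct.
  have hex : ∀ i, ∃ q : Fin T × {p : I.V × I.V | s(p.1, p.2) ∈ I.cut},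
      ∃ j k, P q.1 q.2.1.1 q.2.1.2 j = some ⟨i, k⟩ := by
    intro i
    have k : Fin (I.dem i) := ⟨0, by rw [hI.dem_eq_one]; exact one_pos⟩
    by_contra hno
    have h1 := edist_le_of_holds hP (τ i) (I.snk i) ⟨i, k⟩ (hτ i k) (by
      intro r hr u w huw j hj
      exact hno ⟨(⟨r, hr.trans_le (hτT i)⟩, ⟨(u, w), huw⟩), j, k, hj⟩)
    have h2 : b ≤ τ i := by exact_mod_cast (hdist i).trans h1
    have := hτT i
    omega
  choose q j k hq using hex
  calc Nat.card I.ι ≤ Nat.card (Fin T × {p : I.V × I.V | s(p.1, p.2) ∈ I.cut}) := by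
        refine Nat.card_le_card_of_injective q ?_
        intro i i' h
        have h1 := hq i
        have hcap : I.cap s((q i).2.1.1, (q i).2.1.2) = 1 :=
          hI.cap_eq_one _ (hI.cut_subset (q i).2.2)
        have hsub : Subsingleton (Fin (I.cap s((q i).2.1.1, (q i).2.1.2))) := by
          rw [hcap]; infer_instance
        obtain ⟨j'', hj''⟩ : ∃ j'', P (q i).1 (q i).2.1.1 (q i).2.1.2 j'' = some ⟨i', k i'⟩ := by
          rw [h]; exact ⟨_, hq i'⟩
        rw [Subsingleton.elim j'' (j i), h1] at hj''
        exact congrArg Sigma.fst (Option.some.inj hj'')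
    _ = T * {p : I.V × I.V | s(p.1, p.2) ∈ I.cut}.ncard := by
        rw [Nat.card_prod, Nat.card_fin, Nat.card_coe_set_eq]
    _ ≤ T * (2 * I.cut.ncard) := Nat.mul_le_mul_left _ (Sym2.ncard_pairs_le _)

/-- In `T < b` rounds a cut edge serves at most `2 * T` sessions, fewer than the `r ≥ 2 * b`
sessions that there are per cut edge. -/
theorem le_of_routingMakespanLE (hI : I.IsGapInstance) {b r T : ℕ}
    (hdist : ∀ i, (b : ℕ∞) ≤ (I.graph.deleteEdges I.cut).edist (I.src i) (I.snk i))
    (hcut : 0 < I.cut.ncard) (hr : r * I.cut.ncard ≤ Nat.card I.ι) (hbr : 2 * b ≤ r)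
    (hT : I.RoutingMakespanLE T) : b ≤ T := by
  by_contra hlt
  have h1 := card_sessions_le_of_routing hI hdist hT (by omega)
  have h2 : r * I.cut.ncard ≤ (2 * T) * I.cut.ncard := by
    calc _ ≤ _ := hr
      _ ≤ _ := h1
      _ = _ := by ring
  have := Nat.le_of_mul_le_mul_right h2 hcut
  omega

/-- Flooding the packets one after the other is a routing protocol. -/
theorem exists_routingMakespanLE (hI : I.IsGapInstance) : ∃ T, I.RoutingMakespanLE T := by
  classical
  have := I.finV
  have := I.finι
  have hconn := hI.connected
  set n := Nat.card I.V with hn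
  set k := Nat.card I.ι with hk
  let e : I.ι ≃ Fin k := Finite.equivFin I.ι
  have hlt : ∀ u v, I.graph.dist u v < n := by
    intro u v
    obtain ⟨p, hp, hlen⟩ := hconn.exists_path_of_dist u v
    rw [← hlen]
    have := Fintype.ofFinite I.V
    rw [hn, Nat.card_eq_fintype_card]
    exact hp.length_lt
  -- Round `t` belongs to session number `t / n`. In step `t % n` of its phase all nodes within that
  -- distance of the source send the packet; every distance is below `n`, so `n` steps suffice.
  let P : I.RoutingSchedule := fun t u _ _ =>
    if h : t / n < k then
      if I.graph.dist (I.src (e.symm ⟨t / n, h⟩)) u ≤ t % n then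
        some ⟨e.symm ⟨t / n, h⟩, ⟨0, by rw [hI.dem_eq_one]; exact one_pos⟩⟩
      else none
    else none
  have key : ∀ (i : I.ι) (u : I.V) (t : ℕ), (e i : ℕ) * n + I.graph.dist (I.src i) u ≤ t →
      ∀ j, UnicastInstance.Holds P u t ⟨i, j⟩ := by
    intro i u t ht j
    by_cases h0 : I.src i = u
    · exact Or.inl h0
    · right
      obtain ⟨p, hp⟩ := hconn.exists_walk_length_eq_dist u (I.src i)
      cases p with
      | nil => exact absurd rfl h0
      | @cons _ w _ hadj p =>
        rw [SimpleGraph.Walk.length_cons, SimpleGraph.dist_comm] at hp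
        have hw : I.graph.dist (I.src i) w ≤ p.length := by
          rw [SimpleGraph.dist_comm]; exact SimpleGraph.dist_le p
        have hpn : p.length < n := by have := hlt (I.src i) u; omega
        refine ⟨(e i : ℕ) * n + p.length, by omega, w, hadj.symm, ?_⟩
        have hdiv : ((e i : ℕ) * n + p.length) / n = e i := by
          rw [mul_comm, Nat.mul_add_div (by omega), Nat.div_eq_of_lt hpn, add_zero]
        have hmod : ((e i : ℕ) * n + p.length) % n = p.length := by
          rw [mul_comm, Nat.mul_add_mod, Nat.mod_eq_of_lt hpn]
        have hlt' : ((e i : ℕ) * n + p.length) / n < k := by rw [hdiv]; exact (e i).2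
        have hei : e.symm ⟨((e i : ℕ) * n + p.length) / n, hlt'⟩ = i := by
          rw [Equiv.symm_apply_eq]; exact Fin.ext hdiv
        have hcap : I.cap s(w, u) = 1 := hI.cap_eq_one _ hadj.symm
        refine ⟨⟨0, by rw [hcap]; exact one_pos⟩, ?_⟩
        have hsub : Subsingleton (Fin (I.dem i)) := by rw [hI.dem_eq_one]; infer_instance
        simp only [P]
        rw [dif_pos hlt', if_pos (by rw [hmod, hei]; exact hw)]
        congr 1
        generalize_proofs h4
        revert h4
        rw [hei]
        exact fun _ => congrArg _ (Subsingleton.elim _ _)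
  refine ⟨k * n, P, fun _ => k * n, ?_, ?_, fun _ => le_rfl⟩
  · intro t u v _ j p hp
    simp only [P] at hp
    split_ifs at hp with h1 h2
    obtain rfl := Option.some.inj hp
    refine key _ _ _ ?_ _
    simp only [Equiv.apply_symm_apply]
    have := Nat.div_add_mod t n
    rw [mul_comm] at this
    omega
  · intro i j
    refine key _ _ _ ?_ _
    have h1 := hlt (I.src i) (I.snk i)
    have h2 : ((e i : ℕ) + 1) * n ≤ k * n := Nat.mul_le_mul_right _ (e i).2
    have h3 : ((e i : ℕ) + 1) * n = (e i : ℕ) * n + n := by ring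
    simp only
    omega

end GapInstance

/-! ### Coding protocols with unit capacities and demands -/

namespace UnicastInstance

variable (M : UnicastInstance)

variable {M} in
/-- `SameHistory` for protocols that send one symbol over each edge in each round. -/
def SameUnitHistory {Γ : Type} (P : ℕ → M.V → M.V → (M.ι → Γ) → Γ) (v : M.V) (t : ℕ)
    (x x' : M.ι → Γ) : Prop :=
  (∀ i, M.src i = v → x i = x' i) ∧
    ∀ r < t, ∀ u, M.graph.Adj u v → P r u v x = P r u v x'

/-- `CodingMakespanLE` for protocols that send one symbol over each edge in each round. -/
def UnitCodingMakespanLE (Γ : Type) (T : ℕ) : Prop :=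
  ∃ P : ℕ → M.V → M.V → (M.ι → Γ) → Γ,
    (∀ t u v, M.graph.Adj u v → ∀ x x', SameUnitHistory P u t x x' → P t u v x = P t u v x') ∧
      ∀ i x x', SameUnitHistory P (M.snk i) T x x' → x i = x' i

variable {M}

/-- With unit capacities and demands all families of symbols are indexed by one-element types, so
protocols can be built with single symbols. -/
theorem unitCodingMakespanLE_iff {Γ : Type} [Nonempty Γ] {T : ℕ}
    (hcap : ∀ e ∈ M.graph.edgeSet, M.cap e = 1) (hdem : ∀ i, M.dem i = 1) :
    M.UnitCodingMakespanLE Γ T ↔ M.CodingMakespanLE Γ T := by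
  classical
  have hsub : ∀ i, Subsingleton (Fin (M.dem i)) := fun i => by rw [hdem]; infer_instance
  have hsub' : ∀ u v, M.graph.Adj u v → Subsingleton (Fin (M.cap s(u, v))) :=
    fun u v h => by rw [hcap _ h]; infer_instance
  have zd : ∀ i, Fin (M.dem i) := fun i => ⟨0, by rw [hdem]; exact one_pos⟩
  have zc : ∀ u v, M.graph.Adj u v → Fin (M.cap s(u, v)) :=
    fun u v h => ⟨0, by rw [hcap _ h]; exact one_pos⟩
  obtain ⟨γ⟩ := ‹Nonempty Γ›
  constructor
  · rintro ⟨P, hP, hdec⟩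
    have hsame : ∀ v t (x x' : M.Messages Γ),
        SameHistory (M := M) (fun t u v x _ => P t u v fun i => x i (zd i)) v t x x' →
        SameUnitHistory P v t (fun i => x i (zd i)) (fun i => x' i (zd i)) := by
      intro v t x x' h
      exact ⟨fun i hi => congrFun (h.1 i hi) _,
        fun r hr u hu => congrFun (h.2 r hr u hu) (zc u v hu)⟩
    refine ⟨fun t u v x _ => P t u v fun i => x i (zd i), fun _ => T, ?_, ?_, fun _ => le_rfl⟩
    · intro t u v huv x x' h
      exact funext fun _ => hP t u v huv _ _ (hsame u t x x' h)
    · intro i x x' h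
      have := hdec i _ _ (hsame _ _ x x' h)
      funext j
      rwa [Subsingleton.elim j (zd i)]
  · rintro ⟨P, τ, hP, hdec, hτ⟩
    -- Pairs that are not adjacent may have capacity zero; there the irrelevant default `γ` is used.
    let P' : ℕ → M.V → M.V → (M.ι → Γ) → Γ := fun t u v x =>
      if h : M.graph.Adj u v then P t u v (fun i _ => x i) (zc u v h) else γ
    have hsame : ∀ v t t' (x x' : M.ι → Γ), t' ≤ t → SameUnitHistory P' v t x x' →
        SameHistory P v t' (fun i _ => x i) (fun i _ => x' i) := by
      intro v t t' x x' ht h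
      refine ⟨fun i hi => funext fun _ => h.1 i hi, fun r hr u hu => funext fun j => ?_⟩
      have := h.2 r (hr.trans_le ht) u hu
      simp only [P', dif_pos hu] at this
      have := hsub' u v hu
      rwa [Subsingleton.elim j (zc u v hu)]
    refine ⟨P', ?_, ?_⟩
    · intro t u v huv x x' h
      simp only [P', dif_pos huv]
      exact congrFun (hP t u v huv _ _ (hsame u t t x x' le_rfl h)) _
    · intro i x x' h
      exact congrFun (hdec i _ _ (hsame _ T _ x x' (hτ i) h)) (zd i)

/-- No sink knows its packet in advance. -/
theorem not_codingMakespanLE_zero {Γ : Type} [Nontrivial Γ] (hdem : ∀ i, M.dem i = 1)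
    (hne : ∀ i j, M.src i ≠ M.snk j) (i : M.ι) : ¬ M.CodingMakespanLE Γ 0 := by
  rintro ⟨P, τ, -, hdec, hτ⟩
  obtain ⟨a, b, hab⟩ := exists_pair_ne Γ
  have h := hdec i (fun _ _ => a) (fun _ _ => b) ⟨fun j hj => absurd hj (hne j i), by
    intro r hr
    have := hτ i
    omega⟩
  exact hab (congrFun h ⟨0, by rw [hdem]; exact one_pos⟩)

end UnicastInstance

/-! ### The base instance -/

theorem SimpleGraph.le_edist_of_lipschitz {V : Type*} {G : SimpleGraph V} (φ : V → ℕ)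
    (hφ : ∀ u v, G.Adj u v → φ v ≤ φ u + 1) {x y : V} {b : ℕ} (hb : φ x + b ≤ φ y) :
    (b : ℕ∞) ≤ G.edist x y := by
  have key : ∀ {x y : V} (p : G.Walk x y), φ y ≤ φ x + p.length := by
    intro x y p
    induction p with
    | nil => simp
    | cons h p ih =>
      have := hφ _ _ h
      rw [SimpleGraph.Walk.length_cons]
      omega
  by_contra hlt
  rw [not_le] at hlt
  obtain ⟨p, hp⟩ := SimpleGraph.exists_walk_of_edist_ne_top (ne_top_of_lt hlt)
  rw [← hp] at hlt
  have := key p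
  have h2 : p.length < b := by exact_mod_cast hlt
  omega

namespace BaseInstance

variable {k : ℕ}

theorem adj_iff {a b : BaseNode k} :
    (baseInstance k).graph.Adj a b ↔ BaseEdge k a b ∨ BaseEdge k b a := by
  have h : ∀ a b, BaseEdge k a b → a ≠ b := by rintro a b h rfl; cases h
  change (SimpleGraph.fromRel (BaseEdge k)).Adj a b ↔ _
  rw [SimpleGraph.fromRel_adj]
  constructor
  · exact fun h => h.2
  · rintro (h' | h')
    · exact ⟨h _ _ h', Or.inl h'⟩
    · exact ⟨(h _ _ h').symm, Or.inr h'⟩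

theorem adj {a b : BaseNode k} (h : BaseEdge k a b) : (baseInstance k).graph.Adj a b :=
  adj_iff.2 (Or.inl h)

theorem not_adj_source_sink (i j : Fin k) :
    ¬ (baseInstance k).graph.Adj (BaseNode.source i) (BaseNode.sink j) := by
  rw [adj_iff]
  rintro (h | h) <;> cases h

theorem isGapInstance (k : ℕ) : (baseInstance k).IsGapInstance where
  connected := by
    have hS : ∀ i : Fin k, (baseInstance k).graph.Reachable (BaseNode.source i) BaseNode.hubS :=
      fun i => (adj (.source_hub i)).reachable
    have hT : (baseInstance k).graph.Reachable BaseNode.hubT BaseNode.hubS :=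
      (adj .hub_hub).symm.reachable
    have hm : ∀ p, (baseInstance k).graph.Reachable (BaseNode.mid p false) BaseNode.hubS :=
      fun p => (adj (.path_first p)).symm.reachable.trans (hS _)
    have h : ∀ a, (baseInstance k).graph.Reachable a (BaseNode.hubS : BaseNode k) := by
      rintro (i | i | _ | _ | ⟨p, _ | _⟩)
      · exact hS i
      · exact (adj (.hub_sink i)).symm.reachable.trans hT
      · exact SimpleGraph.Reachable.refl _
      · exact hT
      · exact hm p
      · exact (adj (.path_second p)).symm.reachable.trans (hm p)
    have : Nonempty (baseInstance k).V := ⟨(BaseNode.hubS : BaseNode k)⟩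
    exact ⟨fun a b => (h a).trans (h b).symm⟩
  cut_subset := by
    rintro e rfl
    exact adj .hub_hub
  cap_eq_one _ _ := rfl
  dem_eq_one _ := rfl
  disjoint i j hij := by
    refine ⟨fun h => hij ?_, fun h => ?_, fun h => hij ?_⟩
    · exact BaseNode.source.inj h
    · cases h
    · exact BaseNode.sink.inj h

theorem five_le_edist (i : Fin k) : ((5 : ℕ) : ℕ∞) ≤
    ((baseInstance k).graph.deleteEdges (baseInstance k).cut).edist
      (BaseNode.source i) (BaseNode.sink i) := by
  classical
  -- For at least two sessions this is the distance from source `i` once the hub edge is deleted.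
  -- Only the facts that it changes by at most one along the remaining edges and that it goes from 0
  -- to 5 are used.
  let φ : BaseNode k → ℕ := fun a => match a with
    | .source j => if j = i then 0 else 2
    | .sink j => if j = i then 5 else 3
    | .hubS => 1
    | .hubT => 4
    | .mid p b => if p.1.1 = i then (if b then 2 else 1) else (if b then 4 else 3)
  have hcut : ((baseInstance k).graph.deleteEdges (baseInstance k).cut).Adj ≤
      fun a b => φ b ≤ φ a + 1 := by
    intro a b hab
    obtain ⟨hab, hnot⟩ := SimpleGraph.deleteEdges_adj.1 hab
    rcases adj_iff.1 hab with h | h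
    · cases h with
      | source_hub j => simp only [φ]; split_ifs <;> omega
      | hub_hub => exact absurd rfl hnot
      | hub_sink j => simp only [φ]; split_ifs <;> omega
      | path_first p => simp only [φ]; split_ifs <;> simp_all
      | path_second p => simp only [φ]; split_ifs <;> simp_all
      | path_third p =>
        have := p.2
        simp only [φ]; split_ifs <;> simp_all
    · cases h with
      | source_hub j => simp only [φ]; split_ifs <;> omega
      | hub_hub => exact absurd Sym2.eq_swap hnot
      | hub_sink j => simp only [φ]; split_ifs <;> omega
      | path_first p => simp only [φ]; split_ifs <;> simp_all
      | path_second p => simp only [φ]; split_ifs <;> simp_all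
      | path_third p =>
        have := p.2
        simp only [φ]; split_ifs <;> simp_all
  exact SimpleGraph.le_edist_of_lipschitz φ (fun a b h => hcut a b h) (by simp [φ])

theorem cut_ncard : (baseInstance k).cut.ncard = 1 := Set.ncard_singleton _

theorem edgeSet_ncard_le (hk : 5 ≤ k) : (baseInstance k).graph.edgeSet.ncard ≤ 4 * k ^ 2 := by
  let P := {p : Fin k × Fin k // p.1 ≠ p.2}
  let f : ((Fin k ⊕ Fin k) ⊕ Unit) ⊕ (P ⊕ P) ⊕ P → Sym2 (BaseNode k) :=
    Sum.elim (Sum.elim (Sum.elim (fun i => s(.source i, .hubS)) (fun i => s(.hubT, .sink i)))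
        fun _ => s(.hubS, .hubT))
      (Sum.elim (Sum.elim (fun p => s(.source p.1.1, .mid p false))
        (fun p => s(.mid p false, .mid p true))) (fun p => s(.mid p true, .sink p.1.2)))
  have hsub : (baseInstance k).graph.edgeSet ⊆ Set.range f := by
    intro e
    induction e with
    | _ a b =>
    intro h
    have key : ∀ a b, BaseEdge k a b → s(a, b) ∈ Set.range f := by
      intro a b h
      cases h with
      | source_hub j => exact ⟨.inl (.inl (.inl j)), rfl⟩
      | hub_hub => exact ⟨.inl (.inr ()), rfl⟩
      | hub_sink j => exact ⟨.inl (.inl (.inr j)), rfl⟩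
      | path_first p => exact ⟨.inr (.inl (.inl p)), rfl⟩
      | path_second p => exact ⟨.inr (.inl (.inr p)), rfl⟩
      | path_third p => exact ⟨.inr (.inr p), rfl⟩
    rcases adj_iff.1 h with h | h
    · exact key _ _ h
    · rw [Sym2.eq_swap]; exact key _ _ h
  have hP : Nat.card P ≤ k ^ 2 := by
    calc Nat.card P ≤ Nat.card (Fin k × Fin k) :=
          Nat.card_le_card_of_injective _ Subtype.val_injective
      _ = k ^ 2 := by rw [Nat.card_prod, Nat.card_fin, sq]
  calc (baseInstance k).graph.edgeSet.ncard ≤ (Set.range f).ncard :=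
        Set.ncard_le_ncard hsub (Set.finite_range f)
    _ ≤ Nat.card (((Fin k ⊕ Fin k) ⊕ Unit) ⊕ (P ⊕ P) ⊕ P) := by
        rw [← Nat.card_coe_set_eq]
        exact Nat.card_le_card_of_surjective _ Set.rangeFactorization_surjective
    _ = (k + k + 1) + (Nat.card P + Nat.card P + Nat.card P) := by
        simp only [Nat.card_sum, Nat.card_fin, Nat.card_unique]
    _ ≤ 4 * k ^ 2 := by nlinarith

/-- Any finite alphabet carries an abelian group structure, transported here from `ZMod`. The hubs
forward the sum of all packets, and a sink recovers its own by cancelling the others. -/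
theorem codingMakespanLE (k : ℕ) (Γ : Type) [Finite Γ] [Nontrivial Γ] :
    (baseInstance k).CodingMakespanLE Γ 3 := by
  classical
  have : NeZero (Nat.card Γ) := ⟨Nat.card_pos.ne'⟩
  let e : Γ ≃ ZMod (Nat.card Γ) :=
    (Finite.equivFin Γ).trans (ZMod.finEquiv (Nat.card Γ)).toEquiv
  let _ : AddCommGroup Γ := e.addCommGroup
  rw [← UnicastInstance.unitCodingMakespanLE_iff (isGapInstance k).cap_eq_one
    (isGapInstance k).dem_eq_one]
  -- A node sends `0` until the data it relays has arrived.
  let P : ℕ → BaseNode k → BaseNode k → (Fin k → Γ) → Γ := fun t u _ x => match u with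
    | .source i => x i
    | .hubS => if 1 ≤ t then ∑ i, x i else 0
    | .hubT => if 2 ≤ t then ∑ i, x i else 0
    | .mid p false => if 1 ≤ t then x p.1.1 else 0
    | .mid p true => if 2 ≤ t then x p.1.1 else 0
    | .sink _ => 0
  refine ⟨P, ?_, ?_⟩
  · rintro t (i | i | _ | _ | ⟨p, _ | _⟩) v - x x' ⟨hsrc, hrec⟩
    · exact hsrc i rfl
    · rfl
    · simp only [P]
      split_ifs with ht
      · exact Finset.sum_congr rfl fun i _ => hrec 0 ht _ (adj (.source_hub i))
      · rfl
    · simp only [P]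
      split_ifs with ht
      · simpa [P] using hrec 1 ht _ (adj .hub_hub)
      · rfl
    · simp only [P]
      split_ifs with ht
      · exact hrec 0 ht _ (adj (.path_first p))
      · rfl
    · simp only [P]
      split_ifs with ht
      · simpa [P] using hrec 1 ht _ (adj (.path_second p))
      · rfl
  · rintro (i : Fin k) (x : Fin k → Γ) (x' : Fin k → Γ) ⟨-, hrec⟩
    have h1 : ∑ j, x j = ∑ j, x' j := by
      simpa [P] using hrec 2 (by omega) _ (adj (.hub_sink i))
    have h2 : ∀ j, j ≠ i → x j = x' j := by
      intro j hj
      simpa [P] using hrec 2 (by omega) _ (adj (.path_third ⟨(j, i), hj⟩))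
    rw [← Finset.add_sum_erase _ _ (Finset.mem_univ i),
      ← Finset.add_sum_erase _ x' (Finset.mem_univ i),
      Finset.sum_congr rfl fun j hj => h2 j (Finset.ne_of_mem_erase hj)] at h1
    exact add_right_cancel h1

end BaseInstance

/-! ### The structure of the product -/

namespace GapInstance

/-- All terminals are distinct, and no session has adjacent terminals. -/
structure SeparatedTerminals (I : GapInstance) : Prop where
  src_injective : Function.Injective I.src
  snk_injective : Function.Injective I.snk
  src_ne_snk : ∀ i j, I.src i ≠ I.snk j
  not_adj : ∀ i, ¬ I.graph.Adj (I.src i) (I.snk i)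

section Product

variable (I₁ I₂ : GapInstance) (B : ColoredBipartiteGraph I₁.Arc I₂.ι) (ℓ : ℕ)

/-- The node of the product that is given by a node before merging. -/
def node (a : PreNode I₁ I₂ B ℓ) : (product I₁ I₂ B ℓ).V := Quot.mk _ a

local notation "nd" => node I₁ I₂ B ℓ

variable {I₁ I₂ B ℓ}

theorem node_tail {v : B.L} {w : B.R} (h : B.Adj v w) :
    nd (.inner w (I₂.src (B.χ₂ v w))) = nd (.outer v (B.χ₁ v w).1.fst) :=
  (Quot.sound (Merge.tail v w h)).symm

theorem node_head {v : B.L} {w : B.R} (h : B.Adj v w) :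
    nd (.inner w (I₂.snk (B.χ₂ v w))) = nd (.outer v (B.χ₁ v w).1.snd) :=
  (Quot.sound (Merge.head v w h)).symm

theorem node_path_zero (v : B.L) (e : I₁.cut) :
    nd (.path v e 0) = nd (.outer v (Quot.out e.1).1) :=
  (Quot.sound (Merge.path_start v e)).symm

theorem node_path_last (v : B.L) (e : I₁.cut) :
    nd (.path v e (Fin.last ℓ)) = nd (.outer v (Quot.out e.1).2) :=
  (Quot.sound (Merge.path_end v e)).symm

theorem eq_of_src_eq (hT : I₂.SeparatedTerminals) {v v' : B.L} {w : B.R} (h : B.Adj v w)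
    (h' : B.Adj v' w) (heq : I₂.src (B.χ₂ v w) = I₂.src (B.χ₂ v' w)) : v = v' :=
  (B.session_color w _).unique ⟨h, rfl⟩ ⟨h', (hT.src_injective heq).symm⟩

theorem eq_of_snk_eq (hT : I₂.SeparatedTerminals) {v v' : B.L} {w : B.R} (h : B.Adj v w)
    (h' : B.Adj v' w) (heq : I₂.snk (B.χ₂ v w) = I₂.snk (B.χ₂ v' w)) : v = v' :=
  (B.session_color w _).unique ⟨h, rfl⟩ ⟨h', (hT.snk_injective heq).symm⟩

open Classical in
/-- The canonical representative of a node: its outer copy, if there is one. -/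
noncomputable def representative : PreNode I₁ I₂ B ℓ → PreNode I₁ I₂ B ℓ
  | Sum.inl a => Sum.inl a
  | Sum.inr (Sum.inl (w, p)) =>
    if h : ∃ v, B.Adj v w ∧ p = I₂.src (B.χ₂ v w) then .outer h.choose (B.χ₁ h.choose w).1.fst
    else if h : ∃ v, B.Adj v w ∧ p = I₂.snk (B.χ₂ v w) then
      .outer h.choose (B.χ₁ h.choose w).1.snd
    else .inner w p
  | Sum.inr (Sum.inr (v, e, n)) =>
    if n = 0 then .outer v (Quot.out e.1).1
    else if n = Fin.last ℓ then .outer v (Quot.out e.1).2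
    else .path v e n

/-- Thus `representative` descends to the quotient and decides equality of nodes. Distinct terminals
of `I₂` prevent chains of identifications: an inner node is the terminal of only one session, and no
source is a sink. -/
theorem representative_eq_of_merge (hT : I₂.SeparatedTerminals) (hℓ : 3 ≤ ℓ)
    {a b : PreNode I₁ I₂ B ℓ} (h : Merge I₁ I₂ B ℓ a b) :
    representative a = representative b := by
  cases h with
  | tail v w h =>
    have hex : ∃ v', B.Adj v' w ∧ I₂.src (B.χ₂ v w) = I₂.src (B.χ₂ v' w) := ⟨v, h, rfl⟩
    have : hex.choose = v := (eq_of_src_eq hT h hex.choose_spec.1 hex.choose_spec.2).symm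
    simp only [representative]
    rw [dif_pos hex, this]
  | head v w h =>
    have hno : ¬ ∃ v', B.Adj v' w ∧ I₂.snk (B.χ₂ v w) = I₂.src (B.χ₂ v' w) := by
      rintro ⟨v', -, h'⟩
      exact hT.src_ne_snk _ _ h'.symm
    have hex : ∃ v', B.Adj v' w ∧ I₂.snk (B.χ₂ v w) = I₂.snk (B.χ₂ v' w) := ⟨v, h, rfl⟩
    have : hex.choose = v := (eq_of_snk_eq hT h hex.choose_spec.1 hex.choose_spec.2).symm
    simp only [representative]
    rw [dif_neg hno, dif_pos hex, this]
  | path_start v e => simp [representative]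
  | path_end v e =>
    have : Fin.last ℓ ≠ 0 := by
      intro h
      have := congrArg Fin.val h
      simp only [Fin.val_last, Fin.val_zero] at this
      omega
    simp [representative, this]

theorem representative_eq_of_node_eq (hT : I₂.SeparatedTerminals) (hℓ : 3 ≤ ℓ)
    {a b : PreNode I₁ I₂ B ℓ} (h : nd a = nd b) : representative a = representative b :=
  congrArg (Quot.lift representative fun _ _ h => representative_eq_of_merge hT hℓ h) h

theorem representative_path {v : B.L} {e : I₁.cut} {n : Fin (ℓ + 1)} (h0 : 0 < (n : ℕ))
    (hn : (n : ℕ) < ℓ) :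
    representative (.path v e n : PreNode I₁ I₂ B ℓ) = .path v e n := by
  have h1 : n ≠ 0 := by rintro rfl; simp at h0
  have h2 : n ≠ Fin.last ℓ := by rintro rfl; simp at hn
  simp [representative, h1, h2]

theorem representative_path_cases (v : B.L) (e : I₁.cut) (n : Fin (ℓ + 1)) :
    (∃ x, representative (.path v e n : PreNode I₁ I₂ B ℓ) = .outer v x) ∨
      representative (.path v e n : PreNode I₁ I₂ B ℓ) = .path v e n := by
  simp only [representative]
  split_ifs
  · exact Or.inl ⟨_, rfl⟩
  · exact Or.inl ⟨_, rfl⟩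
  · exact Or.inr rfl

/-- An inner node is merged with at most one outer node. -/
theorem inner_cases (hT : I₂.SeparatedTerminals) (hℓ : 3 ≤ ℓ) (w : B.R) (p : I₂.V) :
    (∃ v, B.Adj v w ∧ p = I₂.src (B.χ₂ v w) ∧
      representative (.inner w p : PreNode I₁ I₂ B ℓ) = .outer v (B.χ₁ v w).1.fst) ∨
    (∃ v, B.Adj v w ∧ p = I₂.snk (B.χ₂ v w) ∧
      representative (.inner w p : PreNode I₁ I₂ B ℓ) = .outer v (B.χ₁ v w).1.snd) ∨
    representative (.inner w p : PreNode I₁ I₂ B ℓ) = .inner w p := by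
  by_cases h : ∃ v, B.Adj v w ∧ p = I₂.src (B.χ₂ v w)
  · obtain ⟨v, h, rfl⟩ := h
    exact Or.inl ⟨v, h, rfl, (representative_eq_of_merge hT hℓ (Merge.tail v w h)).symm⟩
  by_cases h' : ∃ v, B.Adj v w ∧ p = I₂.snk (B.χ₂ v w)
  · obtain ⟨v, h', rfl⟩ := h'
    exact Or.inr (Or.inl ⟨v, h', rfl, (representative_eq_of_merge hT hℓ (Merge.head v w h')).symm⟩)
  · simp only [representative]
    rw [dif_neg h, dif_neg h']
    exact Or.inr (Or.inr rfl)

theorem outer_eq_outer (hT : I₂.SeparatedTerminals) (hℓ : 3 ≤ ℓ) {v v' : B.L} {x x' : I₁.V}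
    (h : nd (.outer v x) = nd (.outer v' x')) : v = v' ∧ x = x' := by
  have := representative_eq_of_node_eq hT hℓ h
  simpa [representative] using this

theorem inner_eq_outer (hT : I₂.SeparatedTerminals) (hℓ : 3 ≤ ℓ) {v : B.L} {w : B.R} {x : I₁.V}
    {p : I₂.V} (h : nd (.inner w p) = nd (.outer v x)) :
    B.Adj v w ∧ ((p = I₂.src (B.χ₂ v w) ∧ x = (B.χ₁ v w).1.fst) ∨
      (p = I₂.snk (B.χ₂ v w) ∧ x = (B.χ₁ v w).1.snd)) := by
  have h1 := representative_eq_of_node_eq hT hℓ h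
  rcases inner_cases (I₁ := I₁) (B := B) hT hℓ w p with ⟨v', hv, hp, h2⟩ | ⟨v', hv, hp, h2⟩ | h2
  · rw [h2] at h1
    obtain ⟨rfl, rfl⟩ := Prod.ext_iff.1 (Sum.inl.inj h1)
    exact ⟨hv, Or.inl ⟨hp, rfl⟩⟩
  · rw [h2] at h1
    obtain ⟨rfl, rfl⟩ := Prod.ext_iff.1 (Sum.inl.inj h1)
    exact ⟨hv, Or.inr ⟨hp, rfl⟩⟩
  · rw [h2] at h1
    exact absurd h1 (by simp [representative])

theorem inner_eq_inner (hT : I₂.SeparatedTerminals) (hℓ : 3 ≤ ℓ) {w w' : B.R}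
    {p p' : I₂.V} (h : nd (.inner w p) = nd (.inner w' p')) :
    (w = w' ∧ p = p') ∨ ∃ v x, nd (.inner w p) = nd (.outer v x) := by
  rcases inner_cases (I₁ := I₁) (B := B) hT hℓ w p with ⟨v, hv, rfl, -⟩ | ⟨v, hv, rfl, -⟩ | h2
  · exact Or.inr ⟨v, _, node_tail hv⟩
  · exact Or.inr ⟨v, _, node_head hv⟩
  rcases inner_cases (I₁ := I₁) (B := B) hT hℓ w' p' with ⟨v, hv, rfl, -⟩ | ⟨v, hv, rfl, -⟩ | h3
  · exact Or.inr ⟨v, _, h.trans (node_tail hv)⟩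
  · exact Or.inr ⟨v, _, h.trans (node_head hv)⟩
  · have h1 := representative_eq_of_node_eq hT hℓ h
    rw [h2, h3] at h1
    left
    simpa using h1

theorem arc_fst_ne_snd (α : I₁.Arc) : α.1.fst ≠ α.1.snd := α.1.adj.ne

/-- Two nodes of one inner copy could only be identified through a common outer node, but the tail
and the head of an arc are distinct. -/
theorem inner_injective (hT : I₂.SeparatedTerminals) (hℓ : 3 ≤ ℓ) {w : B.R}
    {p p' : I₂.V} (h : nd (.inner w p) = nd (.inner w p')) : p = p' := by
  rcases inner_eq_inner hT hℓ h with h1 | ⟨v, x, h1⟩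
  · exact h1.2
  · obtain ⟨-, h2⟩ := inner_eq_outer hT hℓ h1
    obtain ⟨-, h3⟩ := inner_eq_outer hT hℓ (h.symm.trans h1)
    have := arc_fst_ne_snd (B.χ₁ v w)
    rcases h2 with ⟨rfl, rfl⟩ | ⟨rfl, rfl⟩ <;> rcases h3 with ⟨rfl, h4⟩ | ⟨rfl, h4⟩
    · rfl
    · exact absurd h4 this
    · exact absurd h4.symm this
    · rfl

theorem path_eq_path (hT : I₂.SeparatedTerminals) (hℓ : 3 ≤ ℓ) {v v' : B.L} {e e' : I₁.cut}
    {n n' : Fin (ℓ + 1)} (h : nd (.path v e n) = nd (.path v' e' n')) (h0 : 0 < (n : ℕ))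
    (hn : (n : ℕ) < ℓ) : v = v' ∧ e = e' ∧ n = n' := by
  have h1 := representative_eq_of_node_eq hT hℓ h
  rw [representative_path h0 hn] at h1
  rcases representative_path_cases (I₁ := I₁) (I₂ := I₂) v' e' n' with ⟨x, h2⟩ | h2
  · rw [h2] at h1; simp at h1
  · rw [h2] at h1; simpa using h1

theorem path_ne_inner (hT : I₂.SeparatedTerminals) (hℓ : 3 ≤ ℓ) {v : B.L} {e : I₁.cut}
    {n : Fin (ℓ + 1)} (h0 : 0 < (n : ℕ)) (hn : (n : ℕ) < ℓ) (w : B.R) (p : I₂.V) :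
    nd (.path v e n) ≠ nd (.inner w p) := by
  intro h
  have h1 := representative_eq_of_node_eq hT hℓ h
  rw [representative_path h0 hn] at h1
  rcases inner_cases (I₁ := I₁) (B := B) hT hℓ w p with ⟨v, -, -, h2⟩ | ⟨v, -, -, h2⟩ | h2 <;>
    rw [h2] at h1 <;> simp at h1

theorem path_ne_outer (hT : I₂.SeparatedTerminals) (hℓ : 3 ≤ ℓ) {v : B.L} {e : I₁.cut}
    {n : Fin (ℓ + 1)} (h0 : 0 < (n : ℕ)) (hn : (n : ℕ) < ℓ) (v' : B.L) (x : I₁.V) :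
    nd (.path v e n) ≠ nd (.outer v' x) := by
  intro h
  have h1 := representative_eq_of_node_eq hT hℓ h
  rw [representative_path h0 hn] at h1
  simp [representative] at h1

/-- Different inner copies have no edges in common. -/
theorem inner_edge_unique (hT : I₂.SeparatedTerminals) (hℓ : 3 ≤ ℓ)
    (hg : ((5 : ℕ) : ℕ∞) ≤ B.graph.egirth) {w w' : B.R} {p q p' q' : I₂.V}
    (hpq : I₂.graph.Adj p q)
    (hp : nd (.inner w p) = nd (.inner w' p')) (hq : nd (.inner w q) = nd (.inner w' q')) :
    w = w' ∧ p = p' ∧ q = q' := by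
  have hww : w = w' := by
    by_contra hne
    rcases inner_eq_inner hT hℓ hp with h1 | ⟨v, x, h1⟩
    · exact hne h1.1
    rcases inner_eq_inner hT hℓ hq with h2 | ⟨v', x', h2⟩
    · exact hne h2.1
    have a1 := inner_eq_outer hT hℓ h1
    have a2 := inner_eq_outer hT hℓ (hp.symm.trans h1)
    have b1 := inner_eq_outer hT hℓ h2
    have b2 := inner_eq_outer hT hℓ (hq.symm.trans h2)
    -- If the two common ends lie in one outer copy, they are both terminals of one session in `w`
    -- and so not adjacent. Otherwise `v`, `w`, `v'`, `w'` form a four-cycle in `B`.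
    by_cases hv : v = v'
    · subst hv
      rcases a1.2 with ⟨rfl, -⟩ | ⟨rfl, -⟩ <;> rcases b1.2 with ⟨rfl, -⟩ | ⟨rfl, -⟩
      · exact hpq.ne rfl
      · exact hT.not_adj _ hpq
      · exact hT.not_adj _ hpq.symm
      · exact hpq.ne rfl
    · have h4 := hg.trans (SimpleGraph.egirth_le_of_walk_avoiding (B.graph_adj_inl_inr.2 a1.1)
        (B.graph_adj_inl_inr.2 a2.1) (fun h => hne (Sum.inr.inj h))
        (SimpleGraph.Walk.cons (B.graph_adj_inr_inl.2 b1.1)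
          (SimpleGraph.Walk.cons (B.graph_adj_inl_inr.2 b2.1) SimpleGraph.Walk.nil))
        (by simp [hv]))
      simp only [SimpleGraph.Walk.length_cons, SimpleGraph.Walk.length_nil] at h4
      have h5 : 5 ≤ 0 + 1 + 1 + 2 := by exact_mod_cast h4
      omega
  subst hww
  exact ⟨rfl, inner_injective hT hℓ hp, inner_injective hT hℓ hq⟩

/-- Since `3 ≤ ℓ`, each edge of a replacement path has an end strictly inside the path, and such
nodes are never merged. -/
theorem path_edge_ne_inner (hT : I₂.SeparatedTerminals) (hℓ : 3 ≤ ℓ) {v : B.L} {e : I₁.cut}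
    {n : Fin ℓ} {w w' : B.R} {p q : I₂.V} (hp : nd (.path v e n.castSucc) = nd (.inner w p))
    (hq : nd (.path v e n.succ) = nd (.inner w' q)) : False := by
  by_cases h0 : (n : ℕ) = 0
  · exact path_ne_inner hT hℓ (by simp) (by rw [Fin.val_succ]; omega) _ _ hq
  · exact path_ne_inner hT hℓ (by rw [Fin.val_castSucc]; omega) n.2 _ _ hp

theorem path_edge_unique (hT : I₂.SeparatedTerminals) (hℓ : 3 ≤ ℓ) {v v' : B.L} {e e' : I₁.cut}
    {n n' : Fin ℓ} (h : nd (.path v e n.castSucc) = nd (.path v' e' n'.castSucc))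
    (h' : nd (.path v e n.succ) = nd (.path v' e' n'.succ)) : v = v' ∧ e = e' ∧ n = n' := by
  by_cases h0 : (n : ℕ) = 0
  · obtain ⟨h1, h2, h3⟩ := path_eq_path hT hℓ h' (by simp) (by rw [Fin.val_succ]; omega)
    exact ⟨h1, h2, Fin.succ_injective _ h3⟩
  · obtain ⟨h1, h2, h3⟩ := path_eq_path hT hℓ h (by rw [Fin.val_castSucc]; omega) n.2
    exact ⟨h1, h2, Fin.castSucc_injective _ h3⟩

/-- Interior nodes keep their position on the path, so an edge equal to a reversed one forces
incompatible equations between `n` and `n'`. For `ℓ = 2`, `n = 0`, `n' = 1` these equations alone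
would be consistent. -/
theorem path_edge_ne_reverse (hT : I₂.SeparatedTerminals) (hℓ : 3 ≤ ℓ) {v v' : B.L}
    {e e' : I₁.cut} {n n' : Fin ℓ} (h : nd (.path v e n.castSucc) = nd (.path v' e' n'.succ))
    (h' : nd (.path v e n.succ) = nd (.path v' e' n'.castSucc)) : False := by
  have h1 : 0 < (n : ℕ) → (n : ℕ) < ℓ → (n : ℕ) = n' + 1 := fun h0 hn => by
    simpa using congrArg Fin.val (path_eq_path hT hℓ h h0 hn).2.2
  have h2 : 0 < (n : ℕ) + 1 → (n : ℕ) + 1 < ℓ → (n : ℕ) + 1 = n' := fun h0 hn => by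
    simpa using congrArg Fin.val (path_eq_path hT hℓ h' h0 (by simpa using hn)).2.2
  have h3 : 0 < (n' : ℕ) → (n' : ℕ) < ℓ → (n' : ℕ) = n + 1 := fun h0 hn => by
    simpa using congrArg Fin.val (path_eq_path hT hℓ h'.symm h0 hn).2.2
  have h4 : 0 < (n' : ℕ) + 1 → (n' : ℕ) + 1 < ℓ → (n' : ℕ) + 1 = n := fun h0 hn => by
    simpa using congrArg Fin.val (path_eq_path hT hℓ h.symm (by simp) (by simpa using hn)).2.2
  omega

theorem node_ne_of_preEdge (hT : I₂.SeparatedTerminals) (hℓ : 3 ≤ ℓ) {a b : PreNode I₁ I₂ B ℓ}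
    (h : PreEdge I₁ I₂ B ℓ a b) : nd a ≠ nd b := by
  intro heq
  cases h with
  | inner w p q h => exact h.ne (inner_injective hT hℓ heq)
  | path v e n n' h =>
    by_cases h0 : (n : ℕ) = 0
    · have := (path_eq_path hT hℓ heq.symm (by omega) (by omega)).2.2
      rw [this] at h
      omega
    · have := (path_eq_path hT hℓ heq (by omega) (by omega)).2.2
      rw [this] at h
      omega

theorem adj_of_preEdge (hT : I₂.SeparatedTerminals) (hℓ : 3 ≤ ℓ) {a b : PreNode I₁ I₂ B ℓ}
    (h : PreEdge I₁ I₂ B ℓ a b) : (product I₁ I₂ B ℓ).graph.Adj (nd a) (nd b) :=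
  (SimpleGraph.fromRel_adj _ _ _).2 ⟨node_ne_of_preEdge hT hℓ h, Or.inl ⟨a, b, h, rfl, rfl⟩⟩

theorem adj_inner (hT : I₂.SeparatedTerminals) (hℓ : 3 ≤ ℓ) (w : B.R) {p q : I₂.V}
    (h : I₂.graph.Adj p q) :
    (product I₁ I₂ B ℓ).graph.Adj (nd (.inner w p)) (nd (.inner w q)) :=
  adj_of_preEdge hT hℓ (PreEdge.inner w p q h)

theorem adj_path (hT : I₂.SeparatedTerminals) (hℓ : 3 ≤ ℓ) (v : B.L) (e : I₁.cut) (n : Fin ℓ) :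
    (product I₁ I₂ B ℓ).graph.Adj (nd (.path v e n.castSucc)) (nd (.path v e n.succ)) :=
  adj_of_preEdge hT hℓ (PreEdge.path v e _ _ (by simp))

variable (I₁ I₂ B ℓ) in
/-- The oriented edges of the product. -/
inductive ProductArc : (product I₁ I₂ B ℓ).V → (product I₁ I₂ B ℓ).V → Prop
  | inner (w : B.R) (p q : I₂.V) (h : I₂.graph.Adj p q) :
      ProductArc (nd (.inner w p)) (nd (.inner w q))
  | forward (v : B.L) (e : I₁.cut) (n : Fin ℓ) :
      ProductArc (nd (.path v e n.castSucc)) (nd (.path v e n.succ))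
  | backward (v : B.L) (e : I₁.cut) (n : Fin ℓ) :
      ProductArc (nd (.path v e n.succ)) (nd (.path v e n.castSucc))

theorem productArc_of_adj {x y : (product I₁ I₂ B ℓ).V}
    (h : (product I₁ I₂ B ℓ).graph.Adj x y) : ProductArc I₁ I₂ B ℓ x y := by
  have hpath : ∀ n n' : Fin (ℓ + 1), (n' : ℕ) = n + 1 →
      ∃ m : Fin ℓ, n = m.castSucc ∧ n' = m.succ := by
    intro n n' h
    have hn : (n : ℕ) < ℓ := by omega
    exact ⟨⟨n, hn⟩, rfl, Fin.ext h⟩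
  rcases ((SimpleGraph.fromRel_adj _ _ _).1 h).2 with ⟨a, b, hab, rfl, rfl⟩ | ⟨a, b, hab, rfl, rfl⟩
  · cases hab with
    | inner w p q h₁ => exact ProductArc.inner w p q h₁
    | path v e n n' h₁ =>
      obtain ⟨m, rfl, rfl⟩ := hpath n n' h₁
      exact ProductArc.forward v e m
  · cases hab with
    | inner w p q h₁ => exact ProductArc.inner w q p h₁.symm
    | path v e n n' h₁ =>
      obtain ⟨m, rfl, rfl⟩ := hpath n n' h₁
      exact ProductArc.backward v e m

/-- Both terminals of a session are outer nodes of the same copy. An edge of a replacement path has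
an interior end, and an edge of an inner copy between them would join the two terminals of an inner
session. -/
theorem product_separatedTerminals (hT₁ : I₁.SeparatedTerminals) (hT : I₂.SeparatedTerminals)
    (hℓ : 3 ≤ ℓ) : (product I₁ I₂ B ℓ).SeparatedTerminals where
  src_injective i j h := by
    obtain ⟨h1, h2⟩ := outer_eq_outer hT hℓ h
    exact Prod.ext h1 (hT₁.src_injective h2)
  snk_injective i j h := by
    obtain ⟨h1, h2⟩ := outer_eq_outer hT hℓ h
    exact Prod.ext h1 (hT₁.snk_injective h2)
  src_ne_snk i j h := hT₁.src_ne_snk _ _ (outer_eq_outer hT hℓ h).2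
  not_adj i h := by
    generalize hx : (product I₁ I₂ B ℓ).src i = x at h
    generalize hy : (product I₁ I₂ B ℓ).snk i = y at h
    have hx' : nd (.outer i.1 (I₁.src i.2)) = x := hx
    have hy' : nd (.outer i.1 (I₁.snk i.2)) = y := hy
    cases productArc_of_adj h with
    | inner w p q hpq =>
      have h1 := (inner_eq_outer hT hℓ hx'.symm).2
      have h2 := (inner_eq_outer hT hℓ hy'.symm).2
      rcases h1 with ⟨rfl, -⟩ | ⟨rfl, -⟩ <;> rcases h2 with ⟨rfl, -⟩ | ⟨rfl, -⟩
      · exact hpq.ne rfl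
      · exact hT.not_adj _ hpq
      · exact hT.not_adj _ hpq.symm
      · exact hpq.ne rfl
    | forward v e n =>
      by_cases h0 : (n : ℕ) = 0
      · exact path_ne_outer hT hℓ (by simp) (by rw [Fin.val_succ]; omega) _ _ hy'.symm
      · exact path_ne_outer hT hℓ (by rw [Fin.val_castSucc]; omega) n.2 _ _ hx'.symm
    | backward v e n =>
      by_cases h0 : (n : ℕ) = 0
      · exact path_ne_outer hT hℓ (by simp) (by rw [Fin.val_succ]; omega) _ _ hx'.symm
      · exact path_ne_outer hT hℓ (by rw [Fin.val_castSucc]; omega) n.2 _ _ hy'.symm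

end Product

end GapInstance

/-! ### Cut, size and distances of the product -/

namespace GapInstance

section Product

variable {I₁ I₂ : GapInstance} {B : ColoredBipartiteGraph I₁.Arc I₂.ι} {ℓ : ℕ}

local notation "nd" => node I₁ I₂ B ℓ

theorem reachable_inner (hI₂ : I₂.IsGapInstance) (hT : I₂.SeparatedTerminals) (hℓ : 3 ≤ ℓ)
    (w : B.R) (p q : I₂.V) :
    (product I₁ I₂ B ℓ).graph.Reachable (nd (.inner w p)) (nd (.inner w q)) :=
  (hI₂.connected.preconnected p q).map
    (⟨fun p => nd (.inner w p), fun h => adj_inner hT hℓ w h⟩ :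
      I₂.graph →g (product I₁ I₂ B ℓ).graph)

theorem reachable_path (hT : I₂.SeparatedTerminals) (hℓ : 3 ≤ ℓ) (v : B.L) (e : I₁.cut)
    (n : Fin (ℓ + 1)) :
    (product I₁ I₂ B ℓ).graph.Reachable (nd (.outer v (Quot.out e.1).1)) (nd (.path v e n)) := by
  rw [← node_path_zero]
  induction n using Fin.induction with
  | zero => exact SimpleGraph.Reachable.refl _
  | succ n ih => exact ih.trans (adj_path hT hℓ v e n).reachable

theorem adj_quot_out (hI₁ : I₁.IsGapInstance) (e : I₁.cut) :
    I₁.graph.Adj (Quot.out e.1).1 (Quot.out e.1).2 := by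
  have h : s((Quot.out e.1).1, (Quot.out e.1).2) = e.1 := Quot.out_eq e.1
  rw [← SimpleGraph.mem_edgeSet, h]
  exact hI₁.cut_subset e.2

theorem quot_out_cases (e : I₁.cut) {x y : I₁.V} (h : s(x, y) = e.1) :
    ((Quot.out e.1).1 = x ∧ (Quot.out e.1).2 = y) ∨
      ((Quot.out e.1).1 = y ∧ (Quot.out e.1).2 = x) := by
  have h' : s((Quot.out e.1).1, (Quot.out e.1).2) = e.1 := Quot.out_eq e.1
  exact Sym2.eq_iff.1 (h'.trans h.symm)

theorem reachable_outer (hI₁ : I₁.IsGapInstance) (hI₂ : I₂.IsGapInstance)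
    (hT : I₂.SeparatedTerminals) (hℓ : 3 ≤ ℓ) (v : B.L) (x y : I₁.V) :
    (product I₁ I₂ B ℓ).graph.Reachable (nd (.outer v x)) (nd (.outer v y)) := by
  have h := hI₁.connected.preconnected x y
  rw [SimpleGraph.reachable_iff_reflTransGen] at h
  induction h with
  | refl => exact SimpleGraph.Reachable.refl _
  | @tail y z _ hyz ih =>
    refine ih.trans ?_
    by_cases hc : s(y, z) ∈ I₁.cut
    · have h1 := reachable_path hT hℓ (B := B) v ⟨s(y, z), hc⟩ (Fin.last ℓ)
      rw [node_path_last] at h1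
      rcases quot_out_cases (⟨s(y, z), hc⟩ : I₁.cut) rfl with ⟨h2, h3⟩ | ⟨h2, h3⟩
      · rwa [h2, h3] at h1
      · rw [h2, h3] at h1
        exact h1.symm
    · obtain ⟨w, ⟨hvw, hw⟩, -⟩ := B.edge_color v ⟨⟨(y, z), hyz⟩, hc⟩
      have h1 := reachable_inner (I₁ := I₁) hI₂ hT hℓ w (I₂.src (B.χ₂ v w)) (I₂.snk (B.χ₂ v w))
      rwa [node_tail hvw, node_head hvw, hw] at h1

theorem product_connected (hI₁ : I₁.IsGapInstance) (hI₂ : I₂.IsGapInstance)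
    (hT : I₂.SeparatedTerminals) (hℓ : 3 ≤ ℓ) (hB : B.graph.Connected) :
    (product I₁ I₂ B ℓ).graph.Connected := by
  obtain ⟨x₀⟩ := hI₁.connected.nonempty
  obtain ⟨p₀⟩ := hI₂.connected.nonempty
  let c : B.L ⊕ B.R → (product I₁ I₂ B ℓ).V :=
    Sum.elim (fun v => nd (.outer v x₀)) (fun w => nd (.inner w p₀))
  have hstep : ∀ v w, B.Adj v w → (product I₁ I₂ B ℓ).graph.Reachable
      (nd (.outer v x₀)) (nd (.inner w p₀)) := by
    intro v w h
    have h1 := reachable_inner (I₁ := I₁) hI₂ hT hℓ w (I₂.src (B.χ₂ v w)) p₀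
    rw [node_tail h] at h1
    exact (reachable_outer hI₁ hI₂ hT hℓ v _ _).trans h1
  have hc : ∀ a b, (product I₁ I₂ B ℓ).graph.Reachable (c a) (c b) := by
    intro a b
    have h := hB.preconnected a b
    rw [SimpleGraph.reachable_iff_reflTransGen] at h
    induction h with
    | refl => exact SimpleGraph.Reachable.refl _
    | @tail y z _ hyz ih =>
      refine ih.trans ?_
      rcases y with v | w <;> rcases z with v' | w'
      · exact absurd hyz B.not_graph_adj_inl_inl
      · exact hstep v w' (B.graph_adj_inl_inr.1 hyz)
      · exact (hstep v' w (B.graph_adj_inr_inl.1 hyz)).symm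
      · exact absurd hyz B.not_graph_adj_inr_inr
  have hall : ∀ u, ∃ a, (product I₁ I₂ B ℓ).graph.Reachable u (c a) := by
    rintro ⟨⟨v, x⟩ | ⟨w, p⟩ | ⟨v, e, n⟩⟩
    · exact ⟨Sum.inl v, reachable_outer hI₁ hI₂ hT hℓ v x x₀⟩
    · exact ⟨Sum.inr w, reachable_inner hI₂ hT hℓ w p p₀⟩
    · exact ⟨Sum.inl v, (reachable_path hT hℓ v e n).symm.trans
        (reachable_outer hI₁ hI₂ hT hℓ v _ x₀)⟩
  obtain ⟨a₀⟩ := hB.nonempty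
  have : Nonempty (product I₁ I₂ B ℓ).V := ⟨c a₀⟩
  refine ⟨fun u u' => ?_⟩
  obtain ⟨a, ha⟩ := hall u
  obtain ⟨a', ha'⟩ := hall u'
  exact ha.trans ((hc a a').trans ha'.symm)

theorem product_isGapInstance (hI₁ : I₁.IsGapInstance) (hI₂ : I₂.IsGapInstance)
    (hT₁ : I₁.SeparatedTerminals) (hT : I₂.SeparatedTerminals) (hℓ : 3 ≤ ℓ)
    (hB : B.graph.Connected) : (product I₁ I₂ B ℓ).IsGapInstance where
  connected := product_connected hI₁ hI₂ hT hℓ hB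
  cut_subset := by
    rintro _ ⟨a, b, hab, rfl⟩
    cases hab with
    | inner w p q h => exact adj_inner hT hℓ w (hI₂.cut_subset h)
    | path v e n n' h h' =>
      exact adj_of_preEdge hT hℓ (PreEdge.path v e n n' (by omega))
  cap_eq_one _ _ := rfl
  dem_eq_one _ := rfl
  disjoint i j hij := by
    have hs := product_separatedTerminals (B := B) hT₁ hT hℓ
    exact ⟨fun h => hij (hs.src_injective h), hs.src_ne_snk i j,
      fun h => hij (hs.snk_injective h)⟩

theorem product_sessions_card :
    Nat.card (product I₁ I₂ B ℓ).ι = Nat.card B.L * Nat.card I₁.ι := Nat.card_prod _ _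

theorem product_edgeSet_ncard_le :
    (product I₁ I₂ B ℓ).graph.edgeSet.ncard ≤
      Nat.card B.R * I₂.graph.edgeSet.ncard + Nat.card B.L * (I₁.cut.ncard * ℓ) := by
  have := I₁.finV
  have := I₂.finV
  have := B.finL
  have := B.finR
  let f : (B.R × I₂.graph.edgeSet) ⊕ (B.L × I₁.cut × Fin ℓ) → Sym2 (product I₁ I₂ B ℓ).V :=
    Sum.elim (fun a => a.2.1.map fun p => nd (.inner a.1 p))
      (fun a => s(nd (.path a.1 a.2.1 a.2.2.castSucc), nd (.path a.1 a.2.1 a.2.2.succ)))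
  have hsub : (product I₁ I₂ B ℓ).graph.edgeSet ⊆ Set.range f := by
    intro e
    induction e with
    | _ x y =>
    intro h
    cases productArc_of_adj h with
    | inner w p q h₁ => exact ⟨Sum.inl (w, ⟨s(p, q), h₁⟩), rfl⟩
    | forward v e n => exact ⟨Sum.inr (v, e, n), rfl⟩
    | backward v e n => exact ⟨Sum.inr (v, e, n), Sym2.eq_swap⟩
  calc _ ≤ (Set.range f).ncard := Set.ncard_le_ncard hsub (Set.finite_range f)
    _ ≤ Nat.card ((B.R × I₂.graph.edgeSet) ⊕ (B.L × I₁.cut × Fin ℓ)) := by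
        rw [← Nat.card_coe_set_eq]
        exact Nat.card_le_card_of_surjective _ Set.rangeFactorization_surjective
    _ = _ := by
        rw [Nat.card_sum, Nat.card_prod, Nat.card_prod, Nat.card_prod, Nat.card_fin,
          Nat.card_coe_set_eq, Nat.card_coe_set_eq]

/-- An exact count is needed: the upper bound serves the ratio of sessions, the lower bound the
ratio of edges. The lower bound rests on different inner copies having no common edge, hence on the
girth. -/
theorem product_cut_ncard (hI₂ : I₂.IsGapInstance) (hT : I₂.SeparatedTerminals) (hℓ : 3 ≤ ℓ)
    (hg : ((5 : ℕ) : ℕ∞) ≤ B.graph.egirth) :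
    (product I₁ I₂ B ℓ).cut.ncard =
      Nat.card B.R * I₂.cut.ncard + Nat.card B.L * I₁.cut.ncard := by
  have := I₁.finV
  have := I₂.finV
  have := B.finL
  have := B.finR
  let n₀ : Fin ℓ := ⟨0, by omega⟩
  let f : (B.R × I₂.cut) ⊕ (B.L × I₁.cut) → Sym2 (product I₁ I₂ B ℓ).V :=
    Sum.elim (fun a => a.2.1.map fun p => nd (.inner a.1 p))
      (fun a => s(nd (.path a.1 a.2 n₀.castSucc), nd (.path a.1 a.2 n₀.succ)))
  have hrange : (product I₁ I₂ B ℓ).cut = Set.range f := by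
    ext e
    constructor
    · rintro ⟨a, b, hab, rfl⟩
      cases hab with
      | inner w p q h => exact ⟨Sum.inl (w, ⟨s(p, q), h⟩), rfl⟩
      | path v e n n' h h' =>
        have h1 : n = n₀.castSucc := Fin.ext h
        have h2 : n' = n₀.succ := Fin.ext h'
        subst h1 h2
        exact ⟨Sum.inr (v, e), rfl⟩
    · rintro ⟨⟨w, e, he⟩ | ⟨v, e⟩, rfl⟩
      · induction e with
        | _ p q => exact ⟨_, _, PreCut.inner w p q he, rfl⟩
      · exact ⟨_, _, PreCut.path v e n₀.castSucc n₀.succ rfl rfl, rfl⟩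
  have hno : ∀ (w : B.R) (e : Sym2 I₂.V) (v : B.L) (e' : I₁.cut),
      e.map (fun p => nd (.inner w p)) ≠
        s(nd (.path v e' n₀.castSucc), nd (.path v e' n₀.succ)) := by
    intro w e v e' h
    induction e with
    | _ p q =>
    rcases Sym2.eq_iff.1 h with ⟨h1, h2⟩ | ⟨h1, h2⟩
    · exact path_edge_ne_inner hT hℓ h1.symm h2.symm
    · exact path_edge_ne_inner hT hℓ h2.symm h1.symm
  have hinj : Function.Injective f := by
    rintro (⟨w, e, he⟩ | ⟨v, e⟩) (⟨w', e', he'⟩ | ⟨v', e'⟩) h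
    · induction e with
      | _ p q =>
      induction e' with
      | _ p' q' =>
      have hadj : I₂.graph.Adj p q := hI₂.cut_subset he
      rcases Sym2.eq_iff.1 h with ⟨h1, h2⟩ | ⟨h1, h2⟩
      · obtain ⟨rfl, rfl, rfl⟩ := inner_edge_unique hT hℓ hg hadj h1 h2
        rfl
      · obtain ⟨rfl, rfl, rfl⟩ := inner_edge_unique hT hℓ hg hadj h1 h2
        simp only [Sum.inl.injEq, Prod.mk.injEq, Subtype.mk.injEq, true_and]
        exact Sym2.eq_swap
    · exact absurd h (hno _ _ _ _)
    · exact absurd h.symm (hno _ _ _ _)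
    · rcases Sym2.eq_iff.1 h with ⟨h1, h2⟩ | ⟨h1, h2⟩
      · obtain ⟨rfl, rfl, -⟩ := path_edge_unique hT hℓ h1 h2
        rfl
      · exact (path_edge_ne_reverse hT hℓ h1 h2).elim
  rw [hrange, ← Nat.card_coe_set_eq, Nat.card_range_of_injective hinj, Nat.card_sum, Nat.card_prod,
    Nat.card_prod, Nat.card_coe_set_eq, Nat.card_coe_set_eq]

/-! #### Distances -/

/-- The copy `a` contains the node `u` of the product. -/
def CopyContains (a : B.L ⊕ B.R) (u : (product I₁ I₂ B ℓ).V) : Prop :=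
  match a with
  | Sum.inl v => (∃ x, u = nd (.outer v x)) ∨ ∃ e n, u = nd (.path v e n)
  | Sum.inr w => ∃ p, u = nd (.inner w p)

theorem copyContains_left_unique (hT : I₂.SeparatedTerminals) (hℓ : 3 ≤ ℓ) {v v' : B.L}
    {u : (product I₁ I₂ B ℓ).V} (h : CopyContains (Sum.inl v) u)
    (h' : CopyContains (Sum.inl v') u) : v = v' := by
  have key : ∀ v, CopyContains (Sum.inl v) u → ∃ a, u = nd a ∧
      ((∃ x, representative a = (.outer v x : PreNode I₁ I₂ B ℓ)) ∨
        ∃ e n, representative a = (.path v e n : PreNode I₁ I₂ B ℓ)) := by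
    rintro v (⟨x, rfl⟩ | ⟨e, n, rfl⟩)
    · exact ⟨_, rfl, Or.inl ⟨x, rfl⟩⟩
    · refine ⟨_, rfl, ?_⟩
      rcases representative_path_cases (I₁ := I₁) (I₂ := I₂) v e n with h | h
      · exact Or.inl h
      · exact Or.inr ⟨e, n, h⟩
  obtain ⟨a, rfl, ha⟩ := key v h
  obtain ⟨a', haa, ha'⟩ := key v' h'
  have := representative_eq_of_node_eq hT hℓ haa
  rw [← this] at ha'
  rcases ha with ⟨x, ha⟩ | ⟨e, n, ha⟩ <;> rcases ha' with ⟨x', ha'⟩ | ⟨e', n', ha'⟩ <;>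
    rw [ha] at ha' <;> simp at ha'
  · exact ha'.1
  · exact ha'.1

theorem copyContains_left_right (hT : I₂.SeparatedTerminals) (hℓ : 3 ≤ ℓ) {v : B.L} {w : B.R}
    {u : (product I₁ I₂ B ℓ).V} (h : CopyContains (Sum.inl v) u)
    (h' : CopyContains (Sum.inr w) u) :
    B.Adj v w ∧ ∃ x p, u = nd (.outer v x) ∧ u = nd (.inner w p) ∧
      ((p = I₂.src (B.χ₂ v w) ∧ x = (B.χ₁ v w).1.fst) ∨
        (p = I₂.snk (B.χ₂ v w) ∧ x = (B.χ₁ v w).1.snd)) := by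
  obtain ⟨p, rfl⟩ := h'
  have hx : ∃ x, nd (.inner w p) = nd (.outer v x) := by
    rcases h with h | ⟨e, n, h⟩
    · exact h
    · by_cases h0 : n = 0
      · subst h0
        exact ⟨_, h.trans (node_path_zero v e)⟩
      by_cases hl : n = Fin.last ℓ
      · subst hl
        exact ⟨_, h.trans (node_path_last v e)⟩
      · refine absurd h.symm (path_ne_inner hT hℓ (Nat.pos_of_ne_zero fun h => h0 (Fin.ext h)) ?_ _ _)
        exact lt_of_le_of_ne (Nat.lt_succ_iff.1 n.2) fun h => hl (Fin.ext h)
  obtain ⟨x, hx⟩ := hx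
  obtain ⟨h1, h2⟩ := inner_eq_outer hT hℓ hx
  exact ⟨h1, x, p, hx, rfl, h2⟩

open Classical in
/-- The projection of the outer copies to the outer instance; replacement paths without their
first nodes are contracted. -/
noncomputable def outerProjection (x₀ : I₁.V) (u : (product I₁ I₂ B ℓ).V) : I₁.V :=
  if h : ∃ a : B.L × I₁.V, u = nd (.outer a.1 a.2) then h.choose.2
  else if h : ∃ a : B.L × I₁.cut × Fin (ℓ + 1), u = nd (.path a.1 a.2.1 a.2.2) then
    (Quot.out h.choose.2.1.1).2
  else x₀

theorem outerProjection_outer (hT : I₂.SeparatedTerminals) (hℓ : 3 ≤ ℓ) (x₀ : I₁.V) (v : B.L)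
    (x : I₁.V) : outerProjection x₀ (nd (.outer v x)) = x := by
  have h : ∃ a : B.L × I₁.V, nd (.outer v x) = nd (.outer a.1 a.2) := ⟨(v, x), rfl⟩
  rw [outerProjection, dif_pos h]
  exact (outer_eq_outer hT hℓ h.choose_spec).2.symm

theorem outerProjection_path (hT : I₂.SeparatedTerminals) (hℓ : 3 ≤ ℓ) (x₀ : I₁.V) (v : B.L)
    (e : I₁.cut) (n : Fin (ℓ + 1)) (hn : 0 < (n : ℕ)) :
    outerProjection x₀ (nd (.path v e n)) = (Quot.out e.1).2 := by
  by_cases hl : n = Fin.last ℓ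
  · subst hl
    rw [node_path_last, outerProjection_outer hT hℓ]
  · have hn' : (n : ℕ) < ℓ := lt_of_le_of_ne (Nat.lt_succ_iff.1 n.2) fun h => hl (Fin.ext h)
    have hno : ¬ ∃ a : B.L × I₁.V, nd (.path v e n) = nd (.outer a.1 a.2) :=
      fun ⟨a, h⟩ => path_ne_outer hT hℓ hn hn' _ _ h
    have h : ∃ a : B.L × I₁.cut × Fin (ℓ + 1), nd (.path v e n) = nd (.path a.1 a.2.1 a.2.2) :=
      ⟨(v, e, n), rfl⟩
    rw [outerProjection, dif_neg hno, dif_pos h, ← (path_eq_path hT hℓ h.choose_spec hn hn').2.1]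

open Classical in
/-- The projection of an inner copy to the inner instance. -/
noncomputable def innerProjection (p₀ : I₂.V) (w : B.R) (u : (product I₁ I₂ B ℓ).V) : I₂.V :=
  if h : ∃ p, u = nd (.inner w p) then h.choose else p₀

theorem innerProjection_inner (hT : I₂.SeparatedTerminals) (hℓ : 3 ≤ ℓ) (p₀ : I₂.V) (w : B.R)
    (p : I₂.V) : innerProjection p₀ w (nd (.inner w p)) = p := by
  have h : ∃ p', nd (.inner w p) = nd (.inner w p') := ⟨p, rfl⟩
  rw [innerProjection, dif_pos h]
  exact (inner_injective hT hℓ h.choose_spec).symm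

/-- The copies are the spaces of `le_length_of_tree_of_spaces`. An outer copy gets `b₂` times the
distance off the cut in `I₁`; an inner copy gets the distance off the cut in `I₂`, truncated at
`b₂`. They agree on common nodes: the ends of a non-cut arc have scaled distance `b₂`, and the
terminals of an inner session have truncated distance `b₂`. Edges of replacement paths other than
the first, which is cut, have length zero in the projection. -/
theorem product_le_edist (hI₁ : I₁.IsGapInstance) (hI₂ : I₂.IsGapInstance)
    (hT : I₂.SeparatedTerminals) (hℓ : 3 ≤ ℓ) {b₁ b₂ : ℕ}
    (hg : ((2 * (b₁ * b₂) + 1 : ℕ) : ℕ∞) ≤ B.graph.egirth)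
    (h₁ : ∀ i, (b₁ : ℕ∞) ≤ (I₁.graph.deleteEdges I₁.cut).edist (I₁.src i) (I₁.snk i))
    (h₂ : ∀ i, (b₂ : ℕ∞) ≤ (I₂.graph.deleteEdges I₂.cut).edist (I₂.src i) (I₂.snk i))
    (i : (product I₁ I₂ B ℓ).ι) :
    ((b₁ * b₂ : ℕ) : ℕ∞) ≤
      ((product I₁ I₂ B ℓ).graph.deleteEdges (product I₁ I₂ B ℓ).cut).edist
        ((product I₁ I₂ B ℓ).src i) ((product I₁ I₂ B ℓ).snk i) := by
  obtain ⟨x₀⟩ := hI₁.connected.nonempty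
  obtain ⟨p₀⟩ := hI₂.connected.nonempty
  let d : B.L ⊕ B.R → (product I₁ I₂ B ℓ).V → (product I₁ I₂ B ℓ).V → ℕ∞ := fun a u u' =>
    match a with
    | Sum.inl _ => b₂ * (I₁.graph.deleteEdges I₁.cut).edist
        (outerProjection x₀ u) (outerProjection x₀ u')
    | Sum.inr w => min b₂ ((I₂.graph.deleteEdges I₂.cut).edist
        (innerProjection p₀ w u) (innerProjection p₀ w u'))
  have hagree : ∀ v w, B.Adj v w → ∀ u u' : (product I₁ I₂ B ℓ).V,
      CopyContains (Sum.inl v) u → CopyContains (Sum.inl v) u' →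
      CopyContains (Sum.inr w) u → CopyContains (Sum.inr w) u' →
      d (Sum.inl v) u u' = d (Sum.inr w) u u' := by
    intro v w hvw u u' hu hu' hu₂ hu₂'
    obtain ⟨-, x, p, e1, e2, hxp⟩ := copyContains_left_right hT hℓ hu hu₂
    obtain ⟨-, x', p', e1', e2', hxp'⟩ := copyContains_left_right hT hℓ hu' hu₂'
    have hx : outerProjection x₀ u = x := by rw [e1]; exact outerProjection_outer hT hℓ _ _ _
    have hx' : outerProjection x₀ u' = x' := by rw [e1']; exact outerProjection_outer hT hℓ _ _ _
    have hp : innerProjection p₀ w u = p := by rw [e2]; exact innerProjection_inner hT hℓ _ _ _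
    have hp' : innerProjection p₀ w u' = p' := by
      rw [e2']; exact innerProjection_inner hT hℓ _ _ _
    simp only [d]
    rw [hx, hx', hp, hp']
    have harc : (I₁.graph.deleteEdges I₁.cut).edist (B.χ₁ v w).1.fst (B.χ₁ v w).1.snd = 1 := by
      rw [SimpleGraph.edist_eq_one_iff_adj, SimpleGraph.deleteEdges_adj]
      exact ⟨(B.χ₁ v w).1.adj, (B.χ₁ v w).2⟩
    rcases hxp with ⟨rfl, rfl⟩ | ⟨rfl, rfl⟩ <;> rcases hxp' with ⟨rfl, rfl⟩ | ⟨rfl, rfl⟩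
    · simp
    · rw [harc, mul_one, min_eq_left (h₂ _)]
    · rw [SimpleGraph.edist_comm, harc, mul_one, SimpleGraph.edist_comm, min_eq_left (h₂ _)]
    · simp
  by_contra hlt
  rw [not_le] at hlt
  obtain ⟨p, hp⟩ := SimpleGraph.exists_walk_of_edist_ne_top (ne_top_of_lt hlt)
  rw [← hp] at hlt
  have hlen : p.length < b₁ * b₂ := by exact_mod_cast hlt
  have hmain := SimpleGraph.le_length_of_tree_of_spaces (T := B.graph) CopyContains d (b₁ * b₂) hg
    ?_ ?_ ?_ ?_ ?_ p.length hlen (Sum.inl i.1) _ _ p rfl (Or.inl ⟨_, rfl⟩) (Or.inl ⟨_, rfl⟩)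
  · have h3 : d (Sum.inl i.1) ((product I₁ I₂ B ℓ).src i) ((product I₁ I₂ B ℓ).snk i) =
        b₂ * (I₁.graph.deleteEdges I₁.cut).edist (I₁.src i.2) (I₁.snk i.2) := by
      simp only [d]
      congr 2
      · exact outerProjection_outer hT hℓ _ _ _
      · exact outerProjection_outer hT hℓ _ _ _
    rw [h3] at hmain
    have h4 : ((b₁ * b₂ : ℕ) : ℕ∞) ≤ p.length := by
      refine le_trans ?_ hmain
      push_cast
      rw [mul_comm]
      gcongr
      exact h₁ i.2
    exact absurd h4 (not_le.2 hlt)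
  · rintro (v | w) u <;> simp [d]
  · rintro (v | w) u u' u''
    · simp only [d]
      rw [← mul_add]
      gcongr
      exact SimpleGraph.edist_triangle
    · simp only [d]
      refine le_trans (min_le_min_left _
        (SimpleGraph.edist_triangle (v := innerProjection p₀ w u'))) ?_
      generalize (I₂.graph.deleteEdges I₂.cut).edist (innerProjection p₀ w u)
        (innerProjection p₀ w u') = s
      generalize (I₂.graph.deleteEdges I₂.cut).edist (innerProjection p₀ w u')
        (innerProjection p₀ w u'') = t
      rcases le_total (b₂ : ℕ∞) s with hs | hs
      · rw [min_eq_left hs]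
        exact (min_le_left _ _).trans le_self_add
      rcases le_total (b₂ : ℕ∞) t with ht | ht
      · rw [min_eq_left ht]
        exact (min_le_left _ _).trans le_add_self
      · rw [min_eq_right hs, min_eq_right ht]
        exact min_le_right _ _
  · intro u u' huu
    rw [SimpleGraph.deleteEdges_adj] at huu
    obtain ⟨hadj, hcut⟩ := huu
    cases productArc_of_adj hadj with
    | inner w p q h =>
      refine ⟨Sum.inr w, ⟨p, rfl⟩, ⟨q, rfl⟩, ?_⟩
      simp only [d, innerProjection_inner hT hℓ]
      refine (min_le_right _ _).trans ?_
      rw [SimpleGraph.edist_le_one_iff_adj_or_eq, SimpleGraph.deleteEdges_adj]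
      exact Or.inl ⟨h, fun hc => hcut ⟨_, _, PreCut.inner w p q hc, rfl⟩⟩
    | forward v e n =>
      refine ⟨Sum.inl v, Or.inr ⟨_, _, rfl⟩, Or.inr ⟨_, _, rfl⟩, ?_⟩
      have hn : 0 < (n : ℕ) := by
        by_contra h0
        exact hcut ⟨_, _, PreCut.path v e n.castSucc n.succ (by simp; omega) (by simp; omega), rfl⟩
      simp only [d]
      rw [outerProjection_path hT hℓ _ _ _ _ (by simpa using hn),
        outerProjection_path hT hℓ _ _ _ _ (by simp)]
      simp
    | backward v e n =>
      refine ⟨Sum.inl v, Or.inr ⟨_, _, rfl⟩, Or.inr ⟨_, _, rfl⟩, ?_⟩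
      have hn : 0 < (n : ℕ) := by
        by_contra h0
        exact hcut ⟨_, _, PreCut.path v e n.castSucc n.succ (by simp; omega) (by simp; omega),
          Sym2.eq_swap⟩
      simp only [d]
      rw [outerProjection_path hT hℓ _ _ _ _ (by simp),
        outerProjection_path hT hℓ _ _ _ _ (by simpa using hn)]
      simp
  · rintro (v | w) (v' | w') hadj u u' hb hb' hc hc'
    · exact absurd hadj B.not_graph_adj_inl_inl
    · exact hagree v w' (B.graph_adj_inl_inr.1 hadj) u u' hb hb' hc hc'
    · exact (hagree v' w (B.graph_adj_inr_inl.1 hadj) u u' hc hc' hb hb').symm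
    · exact absurd hadj B.not_graph_adj_inr_inr
  · rintro (v | w) (v' | w') u hu hu' hne
    · exact absurd (congrArg Sum.inl (copyContains_left_unique hT hℓ hu hu')) hne
    · exact ⟨Sum.inr w', B.graph_adj_inl_inr.2 (copyContains_left_right hT hℓ hu hu').1, hu',
        Or.inl rfl⟩
    · exact ⟨Sum.inl v', B.graph_adj_inr_inl.2 (copyContains_left_right hT hℓ hu' hu).1, hu',
        Or.inl rfl⟩
    · obtain ⟨p, rfl⟩ := hu
      obtain ⟨p', hp'⟩ := hu'
      rcases inner_eq_inner hT hℓ hp' with h | ⟨v, x, h⟩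
      · exact absurd (congrArg Sum.inr h.1) hne
      · exact ⟨Sum.inl v, B.graph_adj_inr_inl.2 (inner_eq_outer hT hℓ h).1, Or.inl ⟨x, h⟩,
          Or.inr (B.graph_adj_inl_inr.2 (inner_eq_outer hT hℓ (hp'.symm.trans h)).1)⟩

end Product

end GapInstance

/-! ### Coding in the product -/

namespace GapInstance

section Product

variable {I₁ I₂ : GapInstance} {B : ColoredBipartiteGraph I₁.Arc I₂.ι} {ℓ : ℕ} {Γ : Type}

local notation "nd" => node I₁ I₂ B ℓ

/-- The outer copy whose arc is served by session `s` of the inner copy `w`. -/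
noncomputable def servedCopy (w : B.R) (s : I₂.ι) : B.L := (B.session_color w s).choose

theorem servedCopy_adj (w : B.R) (s : I₂.ι) : B.Adj (servedCopy w s) w :=
  (B.session_color w s).choose_spec.1.1

theorem servedCopy_color (w : B.R) (s : I₂.ι) : B.χ₂ (servedCopy w s) w = s :=
  (B.session_color w s).choose_spec.1.2

theorem servedCopy_eq {v : B.L} {w : B.R} (h : B.Adj v w) : servedCopy w (B.χ₂ v w) = v :=
  (B.session_color w _).unique ⟨servedCopy_adj _ _, servedCopy_color _ _⟩ ⟨h, rfl⟩

/-- The packets that the inner copy `w` transports while round `ρ` of the outer protocol is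
simulated. -/
noncomputable def innerMessages (P₁ : ℕ → I₁.V → I₁.V → (I₁.ι → Γ) → Γ) (ρ : ℕ) (w : B.R)
    (X : B.L × I₁.ι → Γ) : I₂.ι → Γ := fun s =>
  P₁ ρ (B.χ₁ (servedCopy w s) w).1.fst (B.χ₁ (servedCopy w s) w).1.snd
    fun i => X (servedCopy w s, i)

variable (ℓ) in
/-- The symbols sent over the arcs of the product: each round of the outer protocol is simulated in
`ℓ` rounds, in which the inner protocols run and the symbols on cut edges travel along the
replacement paths. -/
inductive Transmits (P₁ : ℕ → I₁.V → I₁.V → (I₁.ι → Γ) → Γ)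
    (P₂ : ℕ → I₂.V → I₂.V → (I₂.ι → Γ) → Γ) (γ : Γ) (t : ℕ) :
    (product I₁ I₂ B ℓ).V → (product I₁ I₂ B ℓ).V → ((B.L × I₁.ι → Γ) → Γ) → Prop
  | inner (w : B.R) (p q : I₂.V) (h : I₂.graph.Adj p q) :
      Transmits P₁ P₂ γ t (nd (.inner w p)) (nd (.inner w q))
        fun X => P₂ (t % ℓ) p q (innerMessages P₁ (t / ℓ) w X)
  | forward (v : B.L) (e : I₁.cut) (n : Fin ℓ) :
      Transmits P₁ P₂ γ t (nd (.path v e n.castSucc)) (nd (.path v e n.succ))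
        fun X => if t % ℓ = n then
          P₁ (t / ℓ) (Quot.out e.1).1 (Quot.out e.1).2 fun i => X (v, i) else γ
  | backward (v : B.L) (e : I₁.cut) (n : Fin ℓ) :
      Transmits P₁ P₂ γ t (nd (.path v e n.succ)) (nd (.path v e n.castSucc))
        fun X => if t % ℓ + n + 1 = ℓ then
          P₁ (t / ℓ) (Quot.out e.1).2 (Quot.out e.1).1 fun i => X (v, i) else γ

variable {P₁ : ℕ → I₁.V → I₁.V → (I₁.ι → Γ) → Γ} {P₂ : ℕ → I₂.V → I₂.V → (I₂.ι → Γ) → Γ} {γ : Γ}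

/-- An arc of the product stems from exactly one arc of an inner copy or of a replacement path, so
the choice in `productProtocol` is forced. -/
theorem Transmits.unique (hT : I₂.SeparatedTerminals) (hℓ : 3 ≤ ℓ)
    (hg : ((5 : ℕ) : ℕ∞) ≤ B.graph.egirth) {t : ℕ} {x y : (product I₁ I₂ B ℓ).V}
    {f f' : (B.L × I₁.ι → Γ) → Γ} (h : Transmits ℓ P₁ P₂ γ t x y f)
    (h' : Transmits ℓ P₁ P₂ γ t x y f') : f = f' := by
  generalize hx : x = x' at h'
  generalize hy : y = y' at h'
  cases h with
  | inner w p q h =>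
    cases h' with
    | inner w' p' q' h' =>
      obtain ⟨rfl, rfl, rfl⟩ := inner_edge_unique hT hℓ hg h hx hy
      rfl
    | forward v' e' n' => exact (path_edge_ne_inner hT hℓ hx.symm hy.symm).elim
    | backward v' e' n' => exact (path_edge_ne_inner hT hℓ hy.symm hx.symm).elim
  | forward v e n =>
    cases h' with
    | inner w' p' q' h' => exact (path_edge_ne_inner hT hℓ hx hy).elim
    | forward v' e' n' =>
      obtain ⟨rfl, rfl, rfl⟩ := path_edge_unique hT hℓ hx hy
      rfl
    | backward v' e' n' => exact (path_edge_ne_reverse hT hℓ hx hy).elim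
  | backward v e n =>
    cases h' with
    | inner w' p' q' h' => exact (path_edge_ne_inner hT hℓ hy hx).elim
    | forward v' e' n' => exact (path_edge_ne_reverse hT hℓ hy hx).elim
    | backward v' e' n' =>
      obtain ⟨rfl, rfl, rfl⟩ := path_edge_unique hT hℓ hy hx
      rfl

open Classical in
variable (ℓ P₁ P₂ γ) in
/-- The coding protocol of the product. -/
noncomputable def productProtocol (t : ℕ) (x y : (product I₁ I₂ B ℓ).V) :
    (B.L × I₁.ι → Γ) → Γ :=
  if h : ∃ f, Transmits ℓ P₁ P₂ γ t x y f then h.choose else fun _ => γ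

theorem productProtocol_eq (hT : I₂.SeparatedTerminals) (hℓ : 3 ≤ ℓ)
    (hg : ((5 : ℕ) : ℕ∞) ≤ B.graph.egirth) {t : ℕ} {x y : (product I₁ I₂ B ℓ).V}
    {f : (B.L × I₁.ι → Γ) → Γ} (h : Transmits ℓ P₁ P₂ γ t x y f) :
    productProtocol ℓ P₁ P₂ γ t x y = f := by
  have hex : ∃ f, Transmits ℓ P₁ P₂ γ t x y f := ⟨f, h⟩
  rw [productProtocol, dif_pos hex]
  exact hex.choose_spec.unique hT hℓ hg h

theorem productProtocol_inner (hT : I₂.SeparatedTerminals) (hℓ : 3 ≤ ℓ)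
    (hg : ((5 : ℕ) : ℕ∞) ≤ B.graph.egirth) (ρ t : ℕ) (ht : t < ℓ) (w : B.R) {p q : I₂.V}
    (h : I₂.graph.Adj p q) (X : B.L × I₁.ι → Γ) :
    productProtocol ℓ P₁ P₂ γ (ℓ * ρ + t) (nd (.inner w p)) (nd (.inner w q)) X =
      P₂ t p q (innerMessages P₁ ρ w X) := by
  rw [productProtocol_eq hT hℓ hg (Transmits.inner w p q h), Nat.mul_add_mod,
    Nat.mod_eq_of_lt ht, Nat.mul_add_div (by omega), Nat.div_eq_of_lt ht, add_zero]

theorem productProtocol_forward (hT : I₂.SeparatedTerminals) (hℓ : 3 ≤ ℓ)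
    (hg : ((5 : ℕ) : ℕ∞) ≤ B.graph.egirth) (ρ t : ℕ) (ht : t < ℓ) (v : B.L) (e : I₁.cut)
    (n : Fin ℓ) (X : B.L × I₁.ι → Γ) :
    productProtocol ℓ P₁ P₂ γ (ℓ * ρ + t) (nd (.path v e n.castSucc)) (nd (.path v e n.succ)) X =
      if t = n then P₁ ρ (Quot.out e.1).1 (Quot.out e.1).2 (fun i => X (v, i)) else γ := by
  rw [productProtocol_eq hT hℓ hg (Transmits.forward v e n), Nat.mul_add_mod,
    Nat.mod_eq_of_lt ht, Nat.mul_add_div (by omega), Nat.div_eq_of_lt ht, add_zero]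

theorem productProtocol_backward (hT : I₂.SeparatedTerminals) (hℓ : 3 ≤ ℓ)
    (hg : ((5 : ℕ) : ℕ∞) ≤ B.graph.egirth) (ρ t : ℕ) (ht : t < ℓ) (v : B.L) (e : I₁.cut)
    (n : Fin ℓ) (X : B.L × I₁.ι → Γ) :
    productProtocol ℓ P₁ P₂ γ (ℓ * ρ + t) (nd (.path v e n.succ)) (nd (.path v e n.castSucc)) X =
      if t + n + 1 = ℓ then P₁ ρ (Quot.out e.1).2 (Quot.out e.1).1 (fun i => X (v, i)) else γ := by
  rw [productProtocol_eq hT hℓ hg (Transmits.backward v e n), Nat.mul_add_mod,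
    Nat.mod_eq_of_lt ht, Nat.mul_add_div (by omega), Nat.div_eq_of_lt ht, add_zero]

/-- An outer node knows what it would know in the simulated outer protocol. -/
theorem sameUnitHistory_outer (hT : I₂.SeparatedTerminals) (hℓ : 3 ≤ ℓ)
    (hg : ((5 : ℕ) : ℕ∞) ≤ B.graph.egirth)
    (hdec₂ : ∀ i x x', UnicastInstance.SameUnitHistory (M := I₂.toUnicastInstance) P₂ (I₂.snk i) ℓ
      x x' → x i = x' i)
    (ρ : ℕ) (v : B.L) (x : I₁.V) (X X' : B.L × I₁.ι → Γ)
    (h : UnicastInstance.SameUnitHistory (M := (product I₁ I₂ B ℓ).toUnicastInstance)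
      (productProtocol ℓ P₁ P₂ γ) (nd (.outer v x)) (ℓ * ρ) X X') :
    UnicastInstance.SameUnitHistory (M := I₁.toUnicastInstance) P₁ x ρ
      (fun i => X (v, i)) (fun i => X' (v, i)) := by
  obtain ⟨hsrc, hrec⟩ := h
  refine ⟨?_, ?_⟩
  · rintro i rfl
    exact hsrc (v, i) rfl
  · intro r hr y hyx
    have htime : ∀ t < ℓ, ℓ * r + t < ℓ * ρ := by
      intro t ht
      calc ℓ * r + t < ℓ * r + ℓ := by omega
        _ = ℓ * (r + 1) := by ring
        _ ≤ ℓ * ρ := Nat.mul_le_mul_left _ hr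
    -- A symbol on a cut edge arrives in the last of the `ℓ` rounds, over the end of the replacement
    -- path at `x`. One on a non-cut arc is the packet of an inner session whose sink is merged with
    -- `x` and decodes it.
    by_cases hc : s(y, x) ∈ I₁.cut
    · rcases quot_out_cases (⟨s(y, x), hc⟩ : I₁.cut) rfl with ⟨h1, h2⟩ | ⟨h1, h2⟩
      · have hadj := adj_path (I₁ := I₁) hT hℓ v ⟨s(y, x), hc⟩ ⟨ℓ - 1, by omega⟩
        have hend : nd (.path v ⟨s(y, x), hc⟩ (Fin.succ ⟨ℓ - 1, by omega⟩)) =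
            nd (.outer v x) := by
          have : (Fin.succ ⟨ℓ - 1, by omega⟩ : Fin (ℓ + 1)) = Fin.last ℓ := by
            ext; simp; omega
          rw [this, node_path_last, h2]
        have h3 := hrec (ℓ * r + (ℓ - 1)) (htime _ (by omega)) _ (hend ▸ hadj)
        rw [← hend, productProtocol_forward hT hℓ hg _ _ (by omega),
          productProtocol_forward hT hℓ hg _ _ (by omega), if_pos rfl, if_pos rfl, h1, h2] at h3
        exact h3
      · have hadj := (adj_path (I₁ := I₁) hT hℓ v ⟨s(y, x), hc⟩ ⟨0, by omega⟩).symm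
        have hend : nd (.path v ⟨s(y, x), hc⟩ (Fin.castSucc ⟨0, by omega⟩)) =
            nd (.outer v x) := by
          have : (Fin.castSucc ⟨0, by omega⟩ : Fin (ℓ + 1)) = 0 := rfl
          rw [this, node_path_zero, h1]
        have h3 := hrec (ℓ * r + (ℓ - 1)) (htime _ (by omega)) _ (hend ▸ hadj)
        rw [← hend, productProtocol_backward hT hℓ hg _ _ (by omega),
          productProtocol_backward hT hℓ hg _ _ (by omega), if_pos (by simp only; omega),
          if_pos (by simp only; omega), h1, h2] at h3
        exact h3
    · obtain ⟨w, ⟨hvw, hw⟩, -⟩ := B.edge_color v ⟨⟨(y, x), hyx⟩, hc⟩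
      have hend : nd (.inner w (I₂.snk (B.χ₂ v w))) = nd (.outer v x) := by
        rw [node_head hvw, hw]
      have h3 := hdec₂ (B.χ₂ v w) (innerMessages P₁ r w X) (innerMessages P₁ r w X')
        ⟨fun i hi => absurd hi (hT.src_ne_snk _ _), fun t ht p hp => by
          have h4 := hrec (ℓ * r + t) (htime t ht) _ (hend ▸ adj_inner (I₁ := I₁) hT hℓ w hp)
          rwa [← hend, productProtocol_inner hT hℓ hg _ _ ht w hp,
            productProtocol_inner hT hℓ hg _ _ ht w hp] at h4⟩
      simp only [innerMessages, servedCopy_eq hvw, hw] at h3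
      exact h3

/-- When the simulation of outer round `ρ` starts, each outer node knows its simulated history and
hence the symbols it has to send. It is itself the source of the inner sessions or the end of the
paths that carry them, so no time is lost. -/
theorem product_unitCodingMakespanLE (hI₁ : I₁.IsGapInstance) (hT : I₂.SeparatedTerminals)
    (hℓ : 3 ≤ ℓ) (hg : ((5 : ℕ) : ℕ∞) ≤ B.graph.egirth) [Nonempty Γ] {a : ℕ}
    (h₁ : I₁.UnitCodingMakespanLE Γ a) (h₂ : I₂.UnitCodingMakespanLE Γ ℓ) :
    (product I₁ I₂ B ℓ).UnitCodingMakespanLE Γ (ℓ * a) := by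
  obtain ⟨P₁, hP₁, hdec₁⟩ := h₁
  obtain ⟨P₂, hP₂, hdec₂⟩ := h₂
  obtain ⟨γ⟩ := ‹Nonempty Γ›
  refine ⟨productProtocol ℓ P₁ P₂ γ, ?_, ?_⟩
  · rintro t x y hxy (X : B.L × I₁.ι → Γ) (X' : B.L × I₁.ι → Γ) hsame
    obtain ⟨ρ, t', ht', rfl⟩ : ∃ ρ t', t' < ℓ ∧ t = ℓ * ρ + t' :=
      ⟨t / ℓ, t % ℓ, Nat.mod_lt _ (by omega), (Nat.div_add_mod t ℓ).symm⟩
    have houter : ∀ v z, x = nd (.outer v z) →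
        UnicastInstance.SameUnitHistory (M := I₁.toUnicastInstance) P₁ z ρ
          (fun i => X (v, i)) (fun i => X' (v, i)) := by
      rintro v z rfl
      exact sameUnitHistory_outer hT hℓ hg hdec₂ ρ v z X X'
        ⟨hsame.1, fun r hr => hsame.2 r (by omega)⟩
    cases productArc_of_adj hxy with
    | inner w p q hpq =>
      rw [productProtocol_inner hT hℓ hg _ _ ht' w hpq, productProtocol_inner hT hℓ hg _ _ ht' w hpq]
      refine hP₂ t' p q hpq _ _ ⟨?_, ?_⟩
      · rintro s rfl
        have hadj := servedCopy_adj w s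
        have h1 : nd (.inner w (I₂.src s)) =
            nd (.outer (servedCopy w s) (B.χ₁ (servedCopy w s) w).1.fst) := by
          rw [← node_tail hadj, servedCopy_color]
        exact hP₁ ρ _ _ (B.χ₁ (servedCopy w s) w).1.adj _ _ (houter _ _ h1)
      · intro r hr p' hp'
        have h1 := hsame.2 (ℓ * ρ + r) (by omega) _ (adj_inner hT hℓ w hp')
        rwa [productProtocol_inner hT hℓ hg _ _ (by omega) w hp',
          productProtocol_inner hT hℓ hg _ _ (by omega) w hp'] at h1
    | forward v e n =>
      rw [productProtocol_forward hT hℓ hg _ _ ht', productProtocol_forward hT hℓ hg _ _ ht']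
      split_ifs with htn
      · by_cases h0 : (n : ℕ) = 0
        · refine hP₁ ρ _ _ (adj_quot_out hI₁ e) _ _ (houter v _ ?_)
          rw [← node_path_zero]
          congr 2
          exact Fin.ext h0
        · have hn : (n : ℕ) - 1 < ℓ := by omega
          have hnn : (⟨n - 1, hn⟩ : Fin ℓ).succ = n.castSucc := by
            ext; simp; omega
          have h1 := hsame.2 (ℓ * ρ + (n - 1)) (by omega) _
            (hnn ▸ adj_path hT hℓ v e ⟨n - 1, hn⟩)
          rw [← hnn, productProtocol_forward hT hℓ hg _ _ hn,
            productProtocol_forward hT hℓ hg _ _ hn, if_pos rfl, if_pos rfl] at h1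
          exact h1
      · rfl
    | backward v e n =>
      rw [productProtocol_backward hT hℓ hg _ _ ht', productProtocol_backward hT hℓ hg _ _ ht']
      split_ifs with htn
      -- Backward symbols cross the edges in decreasing order, edge `n` in step `ℓ - 1 - n`; the
      -- last edge is fed by the outer node itself.
      · by_cases h0 : (n : ℕ) + 1 = ℓ
        · refine hP₁ ρ _ _ (adj_quot_out hI₁ e).symm _ _ (houter v _ ?_)
          rw [← node_path_last]
          congr 2
          exact Fin.ext h0
        · have hn : (n : ℕ) + 1 < ℓ := by omega
          have hnn : (⟨n + 1, hn⟩ : Fin ℓ).castSucc = n.succ := rfl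
          have h1 := hsame.2 (ℓ * ρ + (t' - 1)) (by omega) _
            (hnn ▸ (adj_path hT hℓ v e ⟨n + 1, hn⟩).symm)
          rw [← hnn, productProtocol_backward hT hℓ hg _ _ (by omega),
            productProtocol_backward hT hℓ hg _ _ (by omega), if_pos (by simp only; omega),
            if_pos (by simp only; omega)] at h1
          exact h1
      · rfl
  · rintro ⟨v, i⟩ X X' hsame
    exact hdec₁ i _ _ (sameUnitHistory_outer hT hℓ hg hdec₂ a v (I₁.snk i) X X' hsame)

end Product

end GapInstance

/-! ### The recursive construction -/

namespace GapInstance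

/-- The bounds on the ratio of edges to cut edges. -/
def edgeRatio : ℕ → ℕ → ℕ
  | 0, r => 4 * r ^ 2
  | i + 1, r => max (edgeRatio i (edgeRatio i (3 * r))) (3 ^ 2 ^ i)

/-- `edgeRatio i r` is bounded by a power of `r` with this exponent. -/
def edgeRatioExponent : ℕ → ℕ
  | 0 => 4
  | i + 1 => 2 * edgeRatioExponent i ^ 2

/-- Twice the exponent is squared at each level, starting from `8 = 2 ^ 3`. -/
theorem two_mul_edgeRatioExponent (i : ℕ) : 2 * edgeRatioExponent i = 2 ^ (3 * 2 ^ i) := by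
  induction i with
  | zero => rfl
  | succ i ih =>
    calc 2 * edgeRatioExponent (i + 1) = (2 * edgeRatioExponent i) ^ 2 := by
          rw [edgeRatioExponent]; ring
      _ = 2 ^ (3 * 2 ^ (i + 1)) := by rw [ih, ← pow_mul]; ring_nf

theorem five_le_edgeRatio (i r : ℕ) (hr : 5 ≤ r) : 5 ≤ edgeRatio i r := by
  induction i generalizing r with
  | zero => rw [edgeRatio]; nlinarith
  | succ i ih => exact (ih _ (ih _ (by omega))).trans (le_max_left _ _)

/-- Composing the bound with itself squares the exponent, and `3 * r ≤ r ^ 2` doubles it. -/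
theorem edgeRatio_le (i r : ℕ) (hr : 5 ≤ r) : edgeRatio i r ≤ r ^ edgeRatioExponent i := by
  induction i generalizing r with
  | zero =>
    calc 4 * r ^ 2 ≤ r ^ 2 * r ^ 2 := Nat.mul_le_mul_right _ (by nlinarith)
      _ = r ^ 4 := by ring
  | succ i ih =>
    have h2 := two_mul_edgeRatioExponent i
    have hexp : 2 ^ i ≤ 2 * edgeRatioExponent i ^ 2 := by
      have h1 : 2 ^ i ≤ 2 * edgeRatioExponent i := by
        rw [h2]
        exact Nat.pow_le_pow_right (by norm_num) (by have := Nat.lt_two_pow_self (n := i); omega)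
      nlinarith
    refine max_le ?_ ?_
    · calc edgeRatio i (edgeRatio i (3 * r))
          ≤ edgeRatio i (3 * r) ^ edgeRatioExponent i :=
            ih _ (five_le_edgeRatio i _ (by omega))
        _ ≤ ((3 * r) ^ edgeRatioExponent i) ^ edgeRatioExponent i :=
            Nat.pow_le_pow_left (ih _ (by omega)) _
        _ ≤ ((r ^ 2) ^ edgeRatioExponent i) ^ edgeRatioExponent i := by
            gcongr
            nlinarith
        _ = r ^ edgeRatioExponent (i + 1) := by rw [edgeRatioExponent]; ring
    · calc 3 ^ 2 ^ i ≤ r ^ 2 ^ i := Nat.pow_le_pow_left (by omega) _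
        _ ≤ r ^ edgeRatioExponent (i + 1) := Nat.pow_le_pow_right (by omega) hexp

/-- The size of a product, in terms of the exponents of the sizes of its factors. -/
theorem product_size_bound {r e μ g m₁ k₁ f₁ A ρ m₂ k₂ L R ℓ : ℕ} (hr : 5 ≤ r) (he : 1 ≤ e)
    (hμ : 1 ≤ μ) (hg : 1 ≤ g) (hm₁ : m₁ ≤ (3 * r) ^ μ) (hk₁ : k₁ ≤ (3 * r) ^ μ) (hf₁ : f₁ ≤ m₁)
    (hA : A ≤ 2 * m₁) (hρ : ρ ≤ (3 * r) ^ e) (hm₂ : m₂ ≤ ρ ^ μ) (hk₂ : k₂ ≤ ρ ^ μ)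
    (hL : L ≤ k₂ * ((8 * (A * k₂) ^ 2) ^ g + 2) ^ 4)
    (hR : R ≤ A * ((8 * (A * k₂) ^ 2) ^ g + 2) ^ 4) (hℓ : ℓ ≤ r ^ g) :
    L * k₁ ≤ r ^ (58 * (e * μ * g)) ∧ R * m₂ + L * (f₁ * ℓ) ≤ r ^ (58 * (e * μ * g)) := by
  set Y := e * μ with hY
  set Z := Y * g with hZ
  -- As `r ≥ 5`, the constants 2 and 3 are absorbed by one factor `r`, 8 by `r ^ 2`, and `3 * r` by
  -- `r ^ 2`. All exponents are then multiples of `Y` or `Z`; 58 is what accumulates.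
  have hμY : μ ≤ Y := Nat.le_mul_of_pos_left _ he
  have hYZ : Y ≤ Z := Nat.le_mul_of_pos_right _ hg
  have hgZ : g ≤ Z := Nat.le_mul_of_pos_left _ (by omega)
  have hmono : ∀ {a b : ℕ}, a ≤ b → r ^ a ≤ r ^ b := fun h => Nat.pow_le_pow_right (by omega) h
  have hsq : ∀ a, (3 * r) ^ a ≤ r ^ (2 * a) := by
    intro a
    rw [pow_mul]
    exact Nat.pow_le_pow_left (by nlinarith) _
  have hm₁' : m₁ ≤ r ^ (2 * Y) := (hm₁.trans (hsq _)).trans (hmono (by omega))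
  have hk₁' : k₁ ≤ r ^ (2 * Z) := (hk₁.trans (hsq _)).trans (hmono (by omega))
  have hρ' : ρ ^ μ ≤ r ^ (2 * Y) := by
    calc ρ ^ μ ≤ (r ^ (2 * e)) ^ μ := Nat.pow_le_pow_left (hρ.trans (hsq _)) _
      _ = r ^ (2 * Y) := by rw [← pow_mul, hY]; ring_nf
  have hm₂' := hm₂.trans hρ'
  have hk₂' := hk₂.trans hρ'
  have hA' : A ≤ r ^ (3 * Y) := by
    calc A ≤ 2 * m₁ := hA
      _ ≤ r * r ^ (2 * Y) := Nat.mul_le_mul (by omega) hm₁'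
      _ = r ^ (2 * Y + 1) := by ring
      _ ≤ r ^ (3 * Y) := hmono (by omega)
  have hd : 8 * (A * k₂) ^ 2 ≤ r ^ (12 * Y) := by
    calc 8 * (A * k₂) ^ 2 ≤ r ^ 2 * (r ^ (3 * Y) * r ^ (2 * Y)) ^ 2 := by
          gcongr
          nlinarith
      _ = r ^ (2 + 10 * Y) := by ring
      _ ≤ r ^ (12 * Y) := hmono (by omega)
  have hq : ((8 * (A * k₂) ^ 2) ^ g + 2) ^ 4 ≤ r ^ (52 * Z) := by
    have h1 : (8 * (A * k₂) ^ 2) ^ g ≤ r ^ (12 * Z) := by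
      calc (8 * (A * k₂) ^ 2) ^ g ≤ (r ^ (12 * Y)) ^ g := Nat.pow_le_pow_left hd _
        _ = r ^ (12 * Z) := by rw [← pow_mul, hZ]; ring_nf
    have h2 : 1 ≤ r ^ (12 * Z) := Nat.one_le_pow _ _ (by omega)
    have h3 : (8 * (A * k₂) ^ 2) ^ g + 2 ≤ r ^ (13 * Z) := by
      calc (8 * (A * k₂) ^ 2) ^ g + 2 ≤ 3 * r ^ (12 * Z) := by omega
        _ ≤ r * r ^ (12 * Z) := Nat.mul_le_mul_right _ (by omega)
        _ = r ^ (12 * Z + 1) := (pow_succ' _ _).symm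
        _ ≤ r ^ (13 * Z) := hmono (by omega)
    calc ((8 * (A * k₂) ^ 2) ^ g + 2) ^ 4 ≤ (r ^ (13 * Z)) ^ 4 := Nat.pow_le_pow_left h3 _
      _ = r ^ (52 * Z) := by rw [← pow_mul]; ring_nf
  have hL' : L ≤ r ^ (54 * Z) := by
    calc L ≤ r ^ (2 * Y) * r ^ (52 * Z) := hL.trans (Nat.mul_le_mul hk₂' hq)
      _ = r ^ (2 * Y + 52 * Z) := by rw [pow_add]
      _ ≤ r ^ (54 * Z) := hmono (by omega)
  have hR' : R ≤ r ^ (55 * Z) := by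
    calc R ≤ r ^ (3 * Y) * r ^ (52 * Z) := hR.trans (Nat.mul_le_mul hA' hq)
      _ = r ^ (3 * Y + 52 * Z) := by rw [pow_add]
      _ ≤ r ^ (55 * Z) := hmono (by omega)
  constructor
  · calc L * k₁ ≤ r ^ (54 * Z) * r ^ (2 * Z) := Nat.mul_le_mul hL' hk₁'
      _ = r ^ (56 * Z) := by rw [← pow_add]; congr 1; omega
      _ ≤ r ^ (58 * Z) := hmono (by omega)
  · have h1 : R * m₂ ≤ r ^ (57 * Z) := by
      calc R * m₂ ≤ r ^ (55 * Z) * r ^ (2 * Y) := Nat.mul_le_mul hR' hm₂'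
        _ = r ^ (55 * Z + 2 * Y) := by rw [pow_add]
        _ ≤ r ^ (57 * Z) := hmono (by omega)
    have h2 : L * (f₁ * ℓ) ≤ r ^ (57 * Z) := by
      calc L * (f₁ * ℓ) ≤ r ^ (54 * Z) * (r ^ (2 * Y) * r ^ g) :=
            Nat.mul_le_mul hL' (Nat.mul_le_mul (hf₁.trans hm₁') hℓ)
        _ = r ^ (54 * Z + 2 * Y + g) := by rw [pow_add, pow_add, mul_assoc]
        _ ≤ r ^ (57 * Z) := hmono (by omega)
    calc R * m₂ + L * (f₁ * ℓ) ≤ 2 * r ^ (57 * Z) := (add_le_add h1 h2).trans_eq (two_mul _).symm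
      _ ≤ r * r ^ (57 * Z) := Nat.mul_le_mul_right _ (by omega)
      _ = r ^ (57 * Z + 1) := (pow_succ' _ _).symm
      _ ≤ r ^ (58 * Z) := hmono (by omega)

/-! ### The invariants of a level and the inductive step. -/

/-- The properties of the instances of level `i` that are maintained in the construction. -/
structure IsLevel (i r : ℕ) (I : GapInstance) : Prop where
  isGapInstance : I.IsGapInstance
  separated : I.SeparatedTerminals
  arc_nonempty : Nonempty I.Arc
  coding : ∀ (Γ : Type) [Finite Γ] [Nontrivial Γ], I.CodingMakespanLE Γ (3 ^ 2 ^ i)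
  dist : ∀ s, ((5 ^ 2 ^ i : ℕ) : ℕ∞) ≤ (I.graph.deleteEdges I.cut).edist (I.src s) (I.snk s)
  cut_pos : 0 < I.cut.ncard
  ratio_sessions : r * I.cut.ncard ≤ Nat.card I.ι
  ratio_edges : I.graph.edgeSet.ncard ≤ edgeRatio i r * I.cut.ncard
  edges_le : I.graph.edgeSet.ncard ≤ r ^ 2 ^ (16 * 2 ^ i)
  sessions_le : Nat.card I.ι ≤ r ^ 2 ^ (16 * 2 ^ i)

theorem IsLevel.sessions_nonempty {i r : ℕ} {I : GapInstance} (h : IsLevel i r I) (hr : 5 ≤ r) :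
    Nonempty I.ι := by
  have h1 := h.ratio_sessions
  have h2 := h.cut_pos
  have : 0 < Nat.card I.ι := by nlinarith
  exact (Nat.card_pos_iff.1 this).1

theorem isLevel_base (r : ℕ) (hr : 5 ≤ r) : IsLevel 0 r (baseInstance r) where
  isGapInstance := BaseInstance.isGapInstance r
  separated :=
    { src_injective := fun _ _ h => BaseNode.source.inj h
      snk_injective := fun _ _ h => BaseNode.sink.inj h
      src_ne_snk := fun _ _ h => by cases h
      not_adj := fun i => BaseInstance.not_adj_source_sink i i }
  arc_nonempty := by
    let i₀ : Fin r := ⟨0, by omega⟩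
    refine ⟨⟨⟨(BaseNode.source i₀, BaseNode.hubS), BaseInstance.adj (.source_hub i₀)⟩, ?_⟩⟩
    intro h
    rcases Sym2.eq_iff.1 h with ⟨h, -⟩ | ⟨h, -⟩ <;> cases h
  coding Γ _ _ := BaseInstance.codingMakespanLE r Γ
  dist := BaseInstance.five_le_edist
  cut_pos := by rw [BaseInstance.cut_ncard]; exact one_pos
  ratio_sessions := by
    rw [BaseInstance.cut_ncard, mul_one]
    exact (Nat.card_fin r).ge
  ratio_edges := by
    rw [BaseInstance.cut_ncard, mul_one]
    exact BaseInstance.edgeSet_ncard_le hr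
  edges_le := by
    calc _ ≤ 4 * r ^ 2 := BaseInstance.edgeSet_ncard_le hr
      _ ≤ r ^ 2 * r ^ 2 := Nat.mul_le_mul_right _ (by nlinarith)
      _ = r ^ 4 := by ring
      _ ≤ r ^ 2 ^ (16 * 2 ^ 0) := Nat.pow_le_pow_right (by omega) (by norm_num)
  sessions_le := by
    calc Nat.card (Fin r) = r ^ 1 := by simp
      _ ≤ r ^ 2 ^ (16 * 2 ^ 0) := Nat.pow_le_pow_right (by omega) (by norm_num)

/-- The second edge of a replacement path is not cut. Arcs are the edge colors at the next level,
where the color set must be nonempty. -/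
theorem product_arc_nonempty {I₁ I₂ : GapInstance} {B : ColoredBipartiteGraph I₁.Arc I₂.ι}
    {ℓ : ℕ} (hT : I₂.SeparatedTerminals) (hℓ : 3 ≤ ℓ) [hL : Nonempty B.L]
    (hcut : I₁.cut.Nonempty) : Nonempty (product I₁ I₂ B ℓ).Arc := by
  obtain ⟨v⟩ := hL
  obtain ⟨e, he⟩ := hcut
  refine ⟨⟨⟨(_, _), adj_path hT hℓ v ⟨e, he⟩ ⟨1, by omega⟩⟩, ?_⟩⟩
  have hpos : 0 < ℓ := by omega
  rintro ⟨a, b, hab, h⟩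
  cases hab with
  | inner w p q h' =>
    rcases Sym2.eq_iff.1 h with ⟨h1, h2⟩ | ⟨h1, h2⟩
    · exact path_edge_ne_inner hT hℓ h1 h2
    · exact path_edge_ne_inner hT hℓ h1 h2
  | path v' e' n n' h0 h1 =>
    have hn : n = (⟨0, hpos⟩ : Fin ℓ).castSucc := Fin.ext h0
    have hn' : n' = (⟨0, hpos⟩ : Fin ℓ).succ := Fin.ext h1
    subst hn hn'
    rcases Sym2.eq_iff.1 h with ⟨h1, h2⟩ | ⟨h1, h2⟩
    · exact absurd (congrArg Fin.val (path_edge_unique hT hℓ h1 h2).2.2) (by simp)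
    · exact path_edge_ne_reverse hT hℓ h1 h2

/-- The product of two instances of level `i` along a suitable graph has level `i + 1`. -/
theorem exists_product_isLevel {i r : ℕ} (hr : 5 ≤ r) {I₁ I₂ : GapInstance}
    (h₁ : IsLevel i (3 * r) I₁) (h₂ : IsLevel i (edgeRatio i (3 * r)) I₂) :
    ∃ B : ColoredBipartiteGraph I₁.Arc I₂.ι,
      ((2 * 5 ^ 2 ^ i * 5 ^ 2 ^ i : ℕ) : ℕ∞) ≤ B.graph.egirth ∧
      IsLevel (i + 1) r (product I₁ I₂ B (3 ^ 2 ^ i)) := by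
  set u₁ := edgeRatio i (3 * r) with hu₁
  have hu₁5 : 5 ≤ u₁ := five_le_edgeRatio i _ (by omega)
  set b := 5 ^ 2 ^ i with hb
  set ℓ := 3 ^ 2 ^ i with hℓdef
  set n := 2 ^ i with hn
  have hn1 : 1 ≤ n := Nat.one_le_two_pow
  have hb5 : 5 ≤ b := by
    calc 5 = 5 ^ 1 := rfl
      _ ≤ 5 ^ n := Nat.pow_le_pow_right (by norm_num) hn1
  have hℓ : 3 ≤ ℓ := by
    calc 3 = 3 ^ 1 := rfl
      _ ≤ 3 ^ n := Nat.pow_le_pow_right (by norm_num) hn1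
  have hb' : 5 ^ 2 ^ (i + 1) = b * b := by rw [hb, ← pow_add, hn, pow_succ]; ring_nf
  have hℓ' : 3 ^ 2 ^ (i + 1) = ℓ * ℓ := by rw [hℓdef, ← pow_add, hn, pow_succ]; ring_nf
  have hT := h₂.separated
  have hfin : Finite I₁.Arc := by
    have := I₁.finV
    exact Finite.of_injective
      (fun a : I₁.Arc => (a.1.fst, a.1.snd)) fun a a' h => Subtype.ext (SimpleGraph.Dart.ext _ _ h)
  have hfin₂ := I₂.finι
  have hne := h₁.arc_nonempty
  have hne₂ := h₂.sessions_nonempty hu₁5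
  -- The distance argument needs girth `2 * N + 1` with `N = b * b`, one more than the girth that is
  -- recorded.
  obtain ⟨B, hg, hconn, hL, hR⟩ :=
    ColoredBipartiteGraph.exists_large_girth I₁.Arc I₂.ι (2 * (b * b) + 1)
  have hg5 : ((5 : ℕ) : ℕ∞) ≤ B.graph.egirth := le_trans (by exact_mod_cast by nlinarith) hg
  have hneL : Nonempty B.L := by
    obtain ⟨v | w⟩ := hconn.nonempty
    · exact ⟨v⟩
    · obtain ⟨s⟩ := hne₂
      exact ⟨servedCopy w s⟩
  have hfinL := B.finL
  have hLpos : 0 < Nat.card B.L := Nat.card_pos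
  have hcut := product_cut_ncard (I₁ := I₁) h₂.isGapInstance hT hℓ hg5
  have hI := product_isGapInstance h₁.isGapInstance h₂.isGapInstance h₁.separated hT hℓ hconn
  have hcount := B.card_left_mul_card
  have hf₁ : I₁.cut.ncard ≤ I₁.graph.edgeSet.ncard := by
    have := I₁.finV
    exact Set.ncard_le_ncard h₁.isGapInstance.cut_subset (Set.toFinite _)
  obtain ⟨hk, hm⟩ : Nat.card B.L * Nat.card I₁.ι ≤ r ^ 2 ^ (16 * 2 ^ (i + 1)) ∧
      Nat.card B.R * I₂.graph.edgeSet.ncard + Nat.card B.L * (I₁.cut.ncard * ℓ) ≤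
        r ^ 2 ^ (16 * 2 ^ (i + 1)) := by
    have he2 := two_mul_edgeRatioExponent i
    have hpos : 0 < 2 ^ (3 * 2 ^ i) := by positivity
    have hngb : n ≤ 2 * (b * b) + 1 := by
      have : n < 5 ^ n := Nat.lt_pow_self (by norm_num)
      rw [← hb] at this
      nlinarith
    have hsize := product_size_bound (e := edgeRatioExponent i) (μ := 2 ^ (16 * n))
      (g := 2 * (b * b) + 1) hr (by omega) Nat.one_le_two_pow (by omega) h₁.edges_le
      h₁.sessions_le hf₁ I₁.card_arc_le (edgeRatio_le i (3 * r) (by omega)) h₂.edges_le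
      h₂.sessions_le hL hR
      (ℓ := ℓ) ((Nat.pow_le_pow_left (by omega) n).trans (Nat.pow_le_pow_right (by omega) hngb))
    -- The factors are at most `2 ^ 6`, `2 ^ (3 * n)`, `2 ^ (16 * n)` and, for the girth, `2 ^ (2 +
    -- 5 * n)`, since `25 ≤ 2 ^ 5`. The constant 16 works because `24 * n + 8 ≤ 32 * n`.
    have hexp : 58 * (edgeRatioExponent i * 2 ^ (16 * n) * (2 * (b * b) + 1)) ≤
        2 ^ (16 * 2 ^ (i + 1)) := by
      have hbb : b * b ≤ 2 ^ (5 * n) := by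
        rw [hb, ← mul_pow, pow_mul]
        exact Nat.pow_le_pow_left (by norm_num) _
      have h1 : 1 ≤ 2 ^ (5 * n) := Nat.one_le_two_pow
      have he : edgeRatioExponent i ≤ 2 ^ (3 * n) := by rw [hn]; omega
      calc 58 * (edgeRatioExponent i * 2 ^ (16 * n) * (2 * (b * b) + 1))
          ≤ 2 ^ 6 * (2 ^ (3 * n) * 2 ^ (16 * n) * (2 ^ 2 * 2 ^ (5 * n))) := by
            gcongr
            · norm_num
            · omega
        _ = 2 ^ (24 * n + 8) := by ring
        _ ≤ 2 ^ (16 * 2 ^ (i + 1)) :=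
            Nat.pow_le_pow_right (by norm_num) (by rw [pow_succ, ← hn]; omega)
    exact ⟨hsize.1.trans (Nat.pow_le_pow_right (by omega) hexp),
      hsize.2.trans (Nat.pow_le_pow_right (by omega) hexp)⟩
  have hedges := product_edgeSet_ncard_le (I₁ := I₁) (I₂ := I₂) (B := B) (ℓ := ℓ)
  refine ⟨B, le_trans (by exact_mod_cast by nlinarith) hg, ?_⟩
  refine ⟨hI, product_separatedTerminals h₁.separated hT hℓ,
    product_arc_nonempty hT hℓ (Set.nonempty_of_ncard_ne_zero h₁.cut_pos.ne'), ?_, ?_, ?_, ?_, ?_,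
    hedges.trans hm, product_sessions_card.trans_le hk⟩
  · intro Γ _ _
    rw [hℓ', ← UnicastInstance.unitCodingMakespanLE_iff hI.cap_eq_one hI.dem_eq_one]
    exact product_unitCodingMakespanLE h₁.isGapInstance hT hℓ hg5
      ((UnicastInstance.unitCodingMakespanLE_iff h₁.isGapInstance.cap_eq_one
        h₁.isGapInstance.dem_eq_one).2 (h₁.coding Γ))
      ((UnicastInstance.unitCodingMakespanLE_iff h₂.isGapInstance.cap_eq_one
        h₂.isGapInstance.dem_eq_one).2 (h₂.coding Γ))
  · rw [hb']
    exact product_le_edist h₁.isGapInstance h₂.isGapInstance hT hℓ hg h₁.dist h₂.dist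
  · rw [hcut]
    have := Nat.mul_pos hLpos h₁.cut_pos
    omega
  · rw [hcut, product_sessions_card]
    -- Cancelling `u₁` shows that the inner cut edges are at most twice the outer ones. With the
    -- first edges of the paths this gives the factor 3 that the outer index `3 * r` compensates.
    have h3 : u₁ * (Nat.card B.R * I₂.cut.ncard) ≤ u₁ * (2 * (Nat.card B.L * I₁.cut.ncard)) := by
      calc u₁ * (Nat.card B.R * I₂.cut.ncard) = Nat.card B.R * (u₁ * I₂.cut.ncard) := by ring
        _ ≤ Nat.card B.R * Nat.card I₂.ι := Nat.mul_le_mul_left _ h₂.ratio_sessions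
        _ = Nat.card B.L * Nat.card I₁.Arc := hcount.symm
        _ ≤ Nat.card B.L * (2 * (u₁ * I₁.cut.ncard)) :=
            Nat.mul_le_mul_left _ (I₁.card_arc_le.trans (Nat.mul_le_mul_left _ h₁.ratio_edges))
        _ = u₁ * (2 * (Nat.card B.L * I₁.cut.ncard)) := by ring
    have h4 := Nat.le_of_mul_le_mul_left h3 (by omega)
    calc r * (Nat.card B.R * I₂.cut.ncard + Nat.card B.L * I₁.cut.ncard)
        ≤ r * (2 * (Nat.card B.L * I₁.cut.ncard) + Nat.card B.L * I₁.cut.ncard) := by gcongr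
      _ = Nat.card B.L * (3 * r * I₁.cut.ncard) := by ring
      _ ≤ Nat.card B.L * Nat.card I₁.ι := Nat.mul_le_mul_left _ h₁.ratio_sessions
  · rw [hcut]
    -- The two terms of the maximum bound the edges per cut edge in the inner copies and on the
    -- replacement paths.
    have h3 : edgeRatio i u₁ ≤ edgeRatio (i + 1) r := le_max_left _ _
    have h4 : ℓ ≤ edgeRatio (i + 1) r := le_max_right _ _
    calc (product I₁ I₂ B ℓ).graph.edgeSet.ncard
        ≤ Nat.card B.R * I₂.graph.edgeSet.ncard + Nat.card B.L * (I₁.cut.ncard * ℓ) := hedges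
      _ ≤ Nat.card B.R * (edgeRatio (i + 1) r * I₂.cut.ncard) +
          Nat.card B.L * (I₁.cut.ncard * edgeRatio (i + 1) r) := by
          gcongr
          exact h₂.ratio_edges.trans (Nat.mul_le_mul_right _ h3)
      _ = edgeRatio (i + 1) r *
          (Nat.card B.R * I₂.cut.ncard + Nat.card B.L * I₁.cut.ncard) := by ring

/-- The instances of all levels. -/
noncomputable def levelInstance :
    (i : ℕ) → {J : ℕ → GapInstance // ∀ r, 5 ≤ r → IsLevel i r (J r)}
  | 0 => ⟨baseInstance, isLevel_base⟩
  | i + 1 =>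
    have hex : ∀ r, 5 ≤ r → _ := fun r (hr : 5 ≤ r) => exists_product_isLevel hr
      ((levelInstance i).2 (3 * r) (by omega))
      ((levelInstance i).2 (edgeRatio i (3 * r)) (five_le_edgeRatio i _ (by omega)))
    ⟨fun r => if hr : 5 ≤ r then
        product ((levelInstance i).1 (3 * r)) ((levelInstance i).1 (edgeRatio i (3 * r)))
          (hex r hr).choose (3 ^ 2 ^ i)
      else baseInstance r,
      fun r hr => by
        simp only [dif_pos hr]
        exact (hex r hr).choose_spec.2⟩

theorem levelInstance_succ (i r : ℕ) (hr : 5 ≤ r) :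
    ∃ B : ColoredBipartiteGraph ((levelInstance i).1 (3 * r)).Arc
        ((levelInstance i).1 (edgeRatio i (3 * r))).ι,
      ((2 * 5 ^ 2 ^ i * 5 ^ 2 ^ i : ℕ) : ℕ∞) ≤ B.graph.egirth ∧
      (levelInstance (i + 1)).1 r =
        product ((levelInstance i).1 (3 * r)) ((levelInstance i).1 (edgeRatio i (3 * r))) B
          (3 ^ 2 ^ i) := by
  have hex := exists_product_isLevel hr
      ((levelInstance i).2 (3 * r) (by omega))
      ((levelInstance i).2 (edgeRatio i (3 * r)) (five_le_edgeRatio i _ (by omega)))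
  refine ⟨hex.choose, hex.choose_spec.1, ?_⟩
  simp only [levelInstance]
  rw [dif_pos hr]

/-! ### Parameters and coding gap of the levels. -/

theorem IsLevel.hasParameters {i r : ℕ} {I : GapInstance} (h : IsLevel i r I) :
    I.HasParameters (3 ^ 2 ^ i) (5 ^ 2 ^ i) I.cut.ncard (Nat.card I.ι) I.graph.edgeSet.ncard r
      (edgeRatio i r) where
  coding := h.coding
  dist := h.dist
  cut_card := rfl
  cut_pos := h.cut_pos
  sessions_card := rfl
  edges_card := le_rfl
  ratio_sessions := by
    rw [le_div_iff₀ (by exact_mod_cast h.cut_pos)]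
    exact_mod_cast h.ratio_sessions
  ratio_edges := by
    rw [div_le_iff₀ (by exact_mod_cast h.cut_pos)]
    exact_mod_cast h.ratio_edges

theorem IsLevel.le_routing {i r : ℕ} {I : GapInstance} (h : IsLevel i r I)
    (hr : 2 * 5 ^ 2 ^ i ≤ r) {T : ℕ} (hT : I.RoutingMakespanLE T) : 5 ^ 2 ^ i ≤ T :=
  le_of_routingMakespanLE h.isGapInstance h.dist h.cut_pos h.ratio_sessions hr hT

/-- Infima of empty sets and quotients by zero are zero, so the bound needs more than the two
estimates: routing and coding protocols must exist, and the coding makespan must be positive. -/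
theorem IsLevel.le_makespanGap {i r : ℕ} {I : GapInstance} (h : IsLevel i r I) (hr5 : 5 ≤ r)
    (hr : 2 * 5 ^ 2 ^ i ≤ r) (Γ : Type) [Finite Γ] [Nontrivial Γ] :
    ((5 : ℝ) / 3) ^ 2 ^ i ≤ I.makespanGap Γ := by
  have h1 : 5 ^ 2 ^ i ≤ I.routingMakespan :=
    h.le_routing hr (Nat.sInf_mem (exists_routingMakespanLE h.isGapInstance))
  have h2 : I.codingMakespan Γ ≤ 3 ^ 2 ^ i := Nat.sInf_le (h.coding Γ)
  have h3 : 0 < I.codingMakespan Γ := by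
    rw [Nat.pos_iff_ne_zero]
    intro h0
    have hmem : I.CodingMakespanLE Γ (I.codingMakespan Γ) :=
      Nat.sInf_mem (s := {T | I.CodingMakespanLE Γ T}) ⟨_, h.coding Γ⟩
    rw [h0] at hmem
    obtain ⟨s⟩ := h.sessions_nonempty hr5
    exact UnicastInstance.not_codingMakespanLE_zero h.isGapInstance.dem_eq_one
      h.separated.src_ne_snk s hmem
  rw [UnicastInstance.makespanGap, div_pow]
  apply div_le_div₀ (Nat.cast_nonneg _)
  · exact_mod_cast h1
  · exact_mod_cast h3
  · exact_mod_cast h2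

/-- From `log x ≤ x` and `2 * 5 ^ n ≤ 2 ^ (4 * n)` one gets `log k ≤ 2 ^ (20 * n)`; the exponent
`logb 2 (5 / 3) / 20` is the one that turns this into `(5 / 3) ^ n`. -/
theorem log_rpow_le {k n : ℕ} (hk : k ≤ (2 * 5 ^ n) ^ 2 ^ (16 * n)) (hn : 1 ≤ n) :
    Real.log k ^ (Real.logb 2 (5 / 3) / 20) ≤ ((5 : ℝ) / 3) ^ n := by
  have hc : 0 < Real.logb 2 (5 / 3) := Real.logb_pos (by norm_num) (by norm_num)
  have hlog : Real.log k ≤ 2 ^ (20 * n) := by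
    rcases Nat.eq_zero_or_pos k with rfl | hk0
    · simp
    have h1 : (2 * 5 ^ n : ℕ) ≤ 2 ^ (4 * n) := by
      calc 2 * 5 ^ n ≤ 2 ^ n * 8 ^ n :=
            Nat.mul_le_mul (by simpa using Nat.pow_le_pow_right (n := 2) (by norm_num) hn)
              (Nat.pow_le_pow_left (by norm_num) n)
        _ = 2 ^ (4 * n) := by rw [← mul_pow, pow_mul]; norm_num
    have hpos : (0 : ℝ) < (2 * 5 ^ n : ℕ) := by positivity
    calc Real.log k ≤ Real.log (((2 * 5 ^ n) ^ 2 ^ (16 * n) : ℕ) : ℝ) :=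
          Real.log_le_log (by exact_mod_cast hk0) (by exact_mod_cast hk)
      _ = 2 ^ (16 * n) * Real.log ((2 * 5 ^ n : ℕ) : ℝ) := by
          rw [Nat.cast_pow, Real.log_pow]; push_cast; rfl
      _ ≤ 2 ^ (16 * n) * ((2 * 5 ^ n : ℕ) : ℝ) := by
          gcongr
          exact Real.log_le_self hpos.le
      _ ≤ 2 ^ (16 * n) * ((2 ^ (4 * n) : ℕ) : ℝ) := by gcongr
      _ = 2 ^ (20 * n) := by push_cast; ring
  calc Real.log k ^ (Real.logb 2 (5 / 3) / 20)
      ≤ ((2 : ℝ) ^ (20 * n)) ^ (Real.logb 2 (5 / 3) / 20) :=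
        Real.rpow_le_rpow (Real.log_natCast_nonneg k) hlog (by positivity)
    _ = ((2 : ℝ) ^ (Real.logb 2 (5 / 3))) ^ n := by
        rw [← Real.rpow_natCast, ← Real.rpow_natCast, ← Real.rpow_mul (by norm_num),
          ← Real.rpow_mul (by norm_num)]
        congr 1
        push_cast
        ring
    _ = ((5 : ℝ) / 3) ^ n := by
        rw [Real.rpow_logb (by norm_num) (by norm_num) (by norm_num)]

end GapInstance

theorem theorem2 :
    ∃ (c C : ℝ) (D : ℕ) (I : ℕ → ℕ → GapInstance) (f k m u : ℕ → ℕ → ℕ),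
      0 < c ∧ 0 < C ∧
      -- level `0`: the base instance
      (∀ r, 5 ≤ r → I 0 r = baseInstance r) ∧
      -- level `i + 1`: a product of two instances of level `i` along a high-girth graph
      (∀ i r, 5 ≤ r →
        ∃ B : ColoredBipartiteGraph (I i (3 * r)).Arc (I i (u i (3 * r))).ι,
          ((2 * 5 ^ 2 ^ i * 5 ^ 2 ^ i : ℕ) : ℕ∞) ≤ B.graph.egirth ∧
          I (i + 1) r =
            GapInstance.product (I i (3 * r)) (I i (u i (3 * r))) B (3 ^ 2 ^ i)) ∧
      -- parameters and size
      (∀ i r, 5 ≤ r →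
        (I i r).IsGapInstance ∧
        (I i r).HasParameters (3 ^ 2 ^ i) (5 ^ 2 ^ i) (f i r) (k i r) (m i r) r (u i r) ∧
        5 ≤ u i r ∧
        m i r ≤ r ^ 2 ^ (D * 2 ^ i) ∧
        k i r ≤ r ^ 2 ^ (D * 2 ^ i)) ∧
      -- routing makespan
      (∀ i r, 2 * 5 ^ 2 ^ i ≤ r → ∀ T, (I i r).RoutingMakespanLE T → 5 ^ 2 ^ i ≤ T) ∧
      -- the infinite family and its gap in terms of the number of sessions
      Filter.Tendsto (fun i => k i (2 * 5 ^ 2 ^ i)) Filter.atTop Filter.atTop ∧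
      ∀ i, ∀ (Γ : Type) [Finite Γ] [Nontrivial Γ],
        C * Real.log (k i (2 * 5 ^ 2 ^ i)) ^ c ≤
          (I i (2 * 5 ^ 2 ^ i)).makespanGap Γ := by
  have hlevel : ∀ i r, 5 ≤ r → GapInstance.IsLevel i r ((GapInstance.levelInstance i).1 r) :=
    fun i => (GapInstance.levelInstance i).2
  have hpow : ∀ i r : ℕ, 2 * 5 ^ 2 ^ i ≤ r → 5 ≤ r := by
    intro i r hr
    have : 5 ^ 1 ≤ 5 ^ 2 ^ i := Nat.pow_le_pow_right (by norm_num) Nat.one_le_two_pow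
    omega
  refine ⟨Real.logb 2 (5 / 3) / 20, 1, 16, fun i => (GapInstance.levelInstance i).1,
    fun i r => ((GapInstance.levelInstance i).1 r).cut.ncard,
    fun i r => Nat.card ((GapInstance.levelInstance i).1 r).ι,
    fun i r => ((GapInstance.levelInstance i).1 r).graph.edgeSet.ncard,
    GapInstance.edgeRatio,
    div_pos (Real.logb_pos (by norm_num) (by norm_num)) (by norm_num), one_pos,
    fun r _ => rfl, GapInstance.levelInstance_succ, ?_, ?_, ?_, ?_⟩
  · intro i r hr
    have h := hlevel i r hr
    exact ⟨h.isGapInstance, h.hasParameters, GapInstance.five_le_edgeRatio i r hr, h.edges_le,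
      h.sessions_le⟩
  · intro i r hr T hT
    exact (hlevel i r (hpow i r hr)).le_routing hr hT
  · refine Filter.tendsto_atTop_mono (f := fun i => i) ?_ Filter.tendsto_id
    intro i
    have h := hlevel i _ (hpow i _ le_rfl)
    have h1 : 2 * 5 ^ 2 ^ i * 1 ≤
        Nat.card ((GapInstance.levelInstance i).1 (2 * 5 ^ 2 ^ i)).ι :=
      (Nat.mul_le_mul_left _ h.cut_pos).trans h.ratio_sessions
    have h2 : i < 2 ^ i := Nat.lt_two_pow_self
    have h3 : 2 ^ i < 5 ^ 2 ^ i := Nat.lt_pow_self (by norm_num)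
    simp only
    omega
  · intro i Γ _ _
    have h := hlevel i _ (hpow i _ le_rfl)
    rw [one_mul]
    exact (GapInstance.log_rpow_le h.sessions_le Nat.one_le_two_pow).trans
      (h.le_makespanGap (hpow i _ le_rfl) le_rfl Γ)
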